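/- Computability is Type-2 computability with names in Baire space $\mathbb N^{\mathbb N}$. A computable metric space $(X,d,\nu)$ is a nonempty metric space with a dense sequence $\nu:\mathbb N\to X$ such that $d(\nu(i),\nu(j))$ is a computable double sequence of reals. Its ideal balls are the balls $\alpha(a)$ with centre in $\nu(\mathbb N)$ and positive rational radius, and $\delta_X$ is its Cauchy representation. Fix a prime $p$ and let $K=\mathbb Q_p$, with $|\cdot|=|\cdot|_p$ and with the Cauchy representation $\delta_K$ obtained from a standard numbering of $\mathbb Q$. Representations. $\Sigma^0_1(X)$: an open set is named by an enumeration (padding allowed) of ideal balls with that union. $\Pi^0_1(X)$: a closed set is named by a name of its complement. $\delta_{\mathrm{range}}$: a closed set is named by a list of names of a dense sequence in it (with a special name for $\emptyset$). $\delta^{>}_{\mathrm{dist}}$: a closed set $A$ is named by a name of a realizer of $x\mapsto d(x,A)$ into the extended reals, represented by enumerations of all rational strict lower bounds. $\mathcal K_{>}(X)$: a compact set is named by a list of exactly all codes of its finite covers by ideal balls. $[\delta_X\to\delta_K]_{\mathcal Z}$: a partial map $X\to K$ that has a continuous realizer and has domain in $\mathcal Z$ is named by (a name of) a continuous realizer together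 with a name of its domain in $\mathcal Z$; these maps form $C_{\mathcal Z}(X,K)$. For total maps $C(X,K)$ the representation $[\delta_X\to\delta_K]$ uses the realizer only. A Dugundji system for a nonempty closed set $A\subseteq X$ is a pair $((V_i)_{i\in\mathbb N},(y_i)_{i\in\mathbb N})$ of open sets $V_i$ and points $y_i\in A$ such that $\bigcup_iV_i=X\setminus A$; every point of $\bigcup_i V_i$ has a neighbourhood meeting only finitely many $V_j$; $d(x,y_i)\le 2\,d(x,A)$ for all $x\in V_i$; and whenever $d(V_{n_i},A)\to0$ for a sequence $(n_i)$ of indices, $\operatorname{diam}V_{n_i}\to0$. It is named by names of all $V_i$ and all $y_i$, a sequence $(B_k)_k$ of (codes of) ideal balls or empty sets with $\bigcup_kB_k=\bigcup_iV_i$, and for each $k$ a finite set of indices containing every $j$ with $V_j\cap B_k\ne\emptyset$; call this representation $\delta_3$, of the set $\mathcal D(X)$ of Dugundji systems. A $K$-valued partition of unity subordinate to $(V_i)_i$ is a sequence of $f_i\in C_{\Sigma^0_1(X)}(X,K)$ with domain $Y=\bigcup_jV_j$ such that $\{x\in Y: f_i(x)\neq0\}\subseteq V_i$ and $|f_i|\le1$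 on $Y$ for every $i$, and $\sum_if_i=1$ on $Y$. A set $C\subseteq K$ is ultrametrically convex if for all $x,y\in C$ the closed ball $\{z:|z-x|\le|x-y|\}$ is contained in $C$. Theorem. Let $X$ be a zero-dimensional computable metric space such that all closed balls $\overline B(x,2^{-N})=\{z:d(x,z)\le2^{-N}\}$ ($x\in X$, $N\in\mathbb N$) are compact and the map $X\times\mathbb N\to\mathcal K_{>}(X)$, $(x,N)\mapsto\overline B(x,2^{-N})$, is computable. Consider all tuples $(A;(V_i)_i,(y_i)_i;(f_i)_i;h)$ where 1. $A\subseteq X$ is closed, $\emptyset\ne A\ne X$, and $((V_i)_i,(y_i)_i)$ is a Dugundji system for $A$; 2. $(f_i)_i$ is a $K$-valued partition of unity subordinate to $(V_i)_i$; 3. $h\in C_{\Pi^0_1(X)}(X,K)$ has domain $A$ and is a homeomorphism from $A$ onto an ultrametrically convex set $h(A)\subseteq K$. For each such tuple and each $x\in X\setminus A$ the sum $\sum_ih(y_i)f_i(x)$ has only finitely many nonzero terms and lies in $h(A)$, so that $$r(x)=x\ \ (x\in A),\qquad r(x)=h^{-1}\Big(\sum_{i\in\mathbb N}h(y_i)f_i(x)\Big)\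 \ (x\in X\setminus A)$$ defines a map $r:X\to X$; $r$ and $h\circ r:X\to K$ are continuous. The operator $\theta$ defined on these tuples by $$\theta\big(A;(V_i)_i,(y_i)_i;(f_i)_i;h\big)=h\circ r\in C(X,K)$$ is $(\delta,[\delta_X\to\delta_K])$-computable, where $\delta=\big[\delta_{\mathrm{range}}\sqcap\delta^{>}_{\mathrm{dist}},\ \delta_3,\ [\delta_X\to\delta_K]_{\Sigma^0_1(X)}^{\omega},\ [\delta_X\to\delta_K]_{\Pi^0_1(X)}\big]$. -/

import Mathlib

open Set Filter Topology

/-! ### Type-two computability on Baire space -/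

/-- Baire space. -/
abbrev Baire : Type := ℕ → ℕ

namespace Baire

/-- The first `k` entries of `q`. -/
def take (q : Baire) (k : ℕ) : List ℕ := (List.range k).map q

/-- A number coding the query "entry `n` of the output, having read the first `k` entries of `q`". -/
def query (n : ℕ) (q : Baire) (k : ℕ) : ℕ := Encodable.encode ((n, take q k) : ℕ × List ℕ)

/-- The canonical representation `p ↦ eta p` of the continuous partial maps of Baire space
with `G_δ` domain. The point `p` is read as the table of a procedure that, to determine entry `n`
of the output on input `q`, inspects longer and longer prefixes of `q`; the value `0` means
"not yet decided" and the first value `m + 1` that occurs means that the entry is `m`.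
The input `q` is in the domain if every entry is decided at some stage.
The computable partial maps are the `eta p` with `p` a recursive function. -/
def eta (p : Baire) : Baire →. Baire := fun q =>
  ⟨∀ n, ∃ k, p (query n q k) ≠ 0, fun hq n => p (query n q (Nat.find (hq n))) - 1⟩

/-- First component of the interleaving pairing `⟨p, q⟩ = (p₀, q₀, p₁, q₁, …)`. -/
def fst (s : Baire) : Baire := fun n => s (2 * n)

/-- Second component of the interleaving pairing. -/
def snd (s : Baire) : Baire := fun n => s (2 * n + 1)

/-- Component `i` of the countable tupling `⟨p⁽⁰⁾, p⁽¹⁾, …⟩`. -/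
def comp (s : Baire) (i : ℕ) : Baire := fun k => s (Nat.pair i k)

end Baire

open Baire

/-- A representation, given by the relation "`p` is a name of `x`". -/
abbrev Naming (X : Type*) := Baire → X → Prop

/-- `F` is a `(δX, δY)`-realizer of the partial map `f`. -/
def Realizes {X Y : Type*} (δX : Naming X) (δY : Naming Y)
    (F : Baire →. Baire) (f : X →. Y) : Prop :=
  ∀ q x y, δX q x → y ∈ f x → ∃ r ∈ F q, δY r y

/-- `f` is `(δX, δY)`-computable. -/
def IsComputableMap {X Y : Type*} (δX : Naming X) (δY : Naming Y) (f : X →. Y) : Prop :=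
  ∃ c : Baire, Computable c ∧ Realizes δX δY (eta c) f

/-- `f` is `(δX, δY)`-continuous: it has a continuous realizer. -/
def IsRelContinuous {X Y : Type*} (δX : Naming X) (δY : Naming Y) (f : X →. Y) : Prop :=
  ∃ c : Baire, Realizes δX δY (eta c) f

/-- The representation `δ_ℕ`. -/
def natNaming : Naming ℕ := fun p n => p 0 = n

/-- The product representation `[δX, δY]`. -/
def prodNaming {X Y : Type*} (δX : Naming X) (δY : Naming Y) : Naming (X × Y) :=
  fun s z => δX (fst s) z.1 ∧ δY (snd s) z.2

/-- The countable power `δ^ω`. -/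
def seqNaming {X : Type*} (δ : Naming X) : Naming (ℕ → X) :=
  fun s x => ∀ i, δ (comp s i) (x i)

/-- The meet `δ ⊓ δ'` of two representations of the same set. -/
def meetNaming {X : Type*} (δ δ' : Naming X) : Naming X :=
  fun s x => δ (fst s) x ∧ δ' (snd s) x

/-- The representation `[δX → δY]` of total relatively continuous maps. -/
def funNaming {X Y : Type*} (δX : Naming X) (δY : Naming Y) : Naming (X → Y) :=
  fun s f => Realizes δX δY (eta s) (PFun.lift f)

/-- The representation `[δX → δY]_𝒵` of partial relatively continuous maps with domain in `𝒵`,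
where `δZ` represents `𝒵`. -/
def pfunNaming {X Y : Type*} (δX : Naming X) (δY : Naming Y) (δZ : Naming (Set X)) :
    Naming (X →. Y) :=
  fun s f => Realizes δX δY (eta (fst s)) f ∧ δZ (snd s) f.Dom

/-! ### Computable metric spaces and their hyperspaces -/

/-- The standard numbering `⟨⟨i, j⟩, k⟩ ↦ (i - j) / (k + 1)` of the rationals. -/
def ratNum (n : ℕ) : ℚ :=
  (((n.unpair.1.unpair.1 : ℚ) - (n.unpair.1.unpair.2 : ℚ))) / ((n.unpair.2 : ℚ) + 1)

/-- The standard numbering `⟨i, k⟩ ↦ (i + 1) / (k + 1)` of the positive rationals. -/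
def posRatNum (n : ℕ) : ℚ := ((n.unpair.1 : ℚ) + 1) / ((n.unpair.2 : ℚ) + 1)

/-- `(X, d, ν)` is a computable metric space: `ν` is dense and the double sequence
`d (ν i) (ν j)` of reals is computable. -/
structure IsComputableMetricSpace {X : Type*} [MetricSpace X] (ν : ℕ → X) : Prop where
  dense : DenseRange ν
  computable_dist : ∃ g : ℕ × ℕ × ℕ → ℕ, Computable g ∧
    ∀ i j k, |dist (ν i) (ν j) - (ratNum (g (i, j, k)) : ℝ)| ≤ (1 / 2 : ℝ) ^ k

/-- Dimension zero, for separable metrizable spaces: the clopen sets form a basis. -/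
def IsZeroDimensional (X : Type*) [TopologicalSpace X] : Prop :=
  TopologicalSpace.IsTopologicalBasis {s : Set X | IsClopen s}

section MetricSpaces

variable {X : Type*} [MetricSpace X]

/-- The Cauchy representation. -/
def cauchyNaming (ν : ℕ → X) : Naming X := fun p x =>
  (∀ i j, dist (ν (p i)) (ν (p j)) < (1 / 2 : ℝ) ^ (min i j)) ∧
    Tendsto (fun i => ν (p i)) atTop (𝓝 x)

/-- The numbering `α` of the ideal open balls. -/
def idealBall (ν : ℕ → X) (a : ℕ) : Set X :=
  Metric.ball (ν a.unpair.1) (posRatNum a.unpair.2 : ℝ)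

/-- The shifted numbering `α'`, with `α' 0 = ∅` and `α' (a + 1) = α a`. -/
def idealBall' (ν : ℕ → X) : ℕ → Set X
  | 0 => ∅
  | a + 1 => idealBall ν a

/-- The representation of the open sets `Σ⁰₁(X)`: `p` enumerates (with `0` as padding)
the codes, plus one, of ideal balls with union `U`. -/
def openNaming (ν : ℕ → X) : Naming (Set X) := fun p U => U = ⋃ i, idealBall' ν (p i)

/-- The representation of the closed sets `Π⁰₁(X)` by names of the complement. -/
def closedNaming (ν : ℕ → X) : Naming (Set X) := fun p A => openNaming ν p Aᶜ

/-- The representation `δ_range` of the closed sets: a name lists names (shifted by one)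
of a dense sequence in `A`, and is identically zero if `A` is empty. -/
def rangeNaming (ν : ℕ → X) : Naming (Set X) := fun s A =>
  IsClosed A ∧
    ((A = ∅ ∧ ∀ i k, comp s i k = 0) ∨
      (A.Nonempty ∧ ∃ z : ℕ → X,
        (∀ i, (∀ k, 1 ≤ comp s i k) ∧ cauchyNaming ν (fun k => comp s i k - 1) (z i) ∧ z i ∈ A) ∧
        A ⊆ closure (range z)))

/-- The representation of the extended reals by enumerations (with `0` as padding)
of all rational lower bounds. -/
def lowerNaming : Naming EReal := fun p t =>
  ∀ n, (((ratNum n : ℝ) : EReal) < t ↔ ∃ i, p i = n + 1)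

/-- The representation `δ_dist^>` of the closed sets: a name realizes the distance function
`d_A` as a lower semicontinuous function (with `d_∅ = ∞`). -/
def distNaming (ν : ℕ → X) : Naming (Set X) := fun p A =>
  IsClosed A ∧ funNaming (cauchyNaming ν) lowerNaming p
    (fun x => ((Metric.infEDist x A : ENNReal) : EReal))

/-- The representation of the compact sets (the space `𝒦_>(X)`): a name of `S` is a list,
without padding, of all codes of finite covers of `S` by ideal balls. -/
def compactNaming (ν : ℕ → X) : Naming (Set X) := fun p S =>
  IsCompact S ∧ ∀ n, (∃ i, p i = n) ↔
    ∃ w : List ℕ, Encodable.encode w = n ∧ S ⊆ ⋃ a ∈ w, idealBall ν a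

/-! ### Dugundji systems -/

/-- The class `LF` for open sets: each point of the union of the family has a basic neighbourhood
that meets only finitely many members. -/
def IsLocallyFiniteInUnion (ν : ℕ → X) (V : ℕ → Set X) : Prop :=
  (∀ i, IsOpen (V i)) ∧
    ∀ i, ∀ x ∈ V i, ∃ a, x ∈ idealBall' ν a ∧ {j | (V j ∩ idealBall' ν a).Nonempty}.Finite

/-- The representation `δ₂`: a name `⟨p, q, r⟩` of `V` consists of names `p` of the open sets
`V j`, a sequence `q` of codes of ideal balls with union `⋃ j, V j`, and for each `i` a
(binary) code `r i` of a finite set containing all `j` such that `V j` meets ball `q i`. -/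
def lfNaming (ν : ℕ → X) : Naming (ℕ → Set X) := fun s V =>
  IsLocallyFiniteInUnion ν V ∧
    seqNaming (openNaming ν) (fst s) V ∧
    (⋃ j, V j) = (⋃ i, idealBall' ν (fst (snd s) i)) ∧
    ∀ i j, (V j ∩ idealBall' ν (fst (snd s) i)).Nonempty → (snd (snd s) i).testBit j = true

/-- `(V, y)` is a Dugundji system for the nonempty closed set `A` with coefficient `1 + ε`.
Distances of sets and diameters are taken in `[0, ∞]`. -/
structure IsDugundjiSystem (ν : ℕ → X) (ε : ℝ) (A : Set X) (V : ℕ → Set X) (y : ℕ → X) :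
    Prop where
  isClosed : IsClosed A
  nonempty : A.Nonempty
  locallyFinite : IsLocallyFiniteInUnion ν V
  iUnion_eq : (⋃ i, V i) = Aᶜ
  mem : ∀ i, y i ∈ A
  dist_le : ∀ i, ∀ x ∈ V i, dist x (y i) ≤ (1 + ε) * Metric.infDist x A
  diam_tendsto : ∀ n : ℕ → ℕ,
    Tendsto (fun i => ⨅ x ∈ V (n i), Metric.infEDist x A) atTop (𝓝 0) →
    Tendsto (fun i => Metric.ediam (V (n i))) atTop (𝓝 0)

/-- The set `𝒟(X)` of Dugundji systems (with coefficient `2`). -/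
def DugundjiSystems (ν : ℕ → X) : Set ((ℕ → Set X) × (ℕ → X)) :=
  {D | IsDugundjiSystem ν 1 (⋃ i, D.1 i)ᶜ D.1 D.2}

/-- The representation `δ₃` of `𝒟(X)`. -/
def dugundjiNaming (ν : ℕ → X) : Naming ((ℕ → Set X) × (ℕ → X)) := fun s D =>
  D ∈ DugundjiSystems ν ∧ prodNaming (lfNaming ν) (seqNaming (cauchyNaming ν)) s D

/-! ### The operator `θ` -/

/-- A subset of an ultrametric space is ultrametrically convex if with `x, y` it contains the
smallest closed ball `[x, y]` containing them. -/
def UltrametricallyConvex (C : Set X) : Prop :=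
  ∀ x ∈ C, ∀ y ∈ C, Metric.closedBall x (dist x y) ⊆ C

open Classical in
/-- The value of a partial map into a field (`0` off the domain, where it is not used). -/
noncomputable def PFun.val {X K : Type*} [Zero K] (f : X →. K) (x : X) : K := (f x).getOrElse 0

variable (p : ℕ) [Fact p.Prime]

/-- The Cauchy representation of `ℚ_p`, from the standard numbering of `ℚ`. -/
def padicNaming : Naming ℚ_[p] := cauchyNaming (fun n => (ratNum n : ℚ_[p]))

variable {p}

/-- `f` is a partition of unity subordinate to the open sets `V` with values in `ℚ_p`. -/
structure IsPadicPartitionOfUnity (ν : ℕ → X) (V : ℕ → Set X) (f : ℕ → X →. ℚ_[p]) : Prop where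
  continuous : ∀ i, IsRelContinuous (cauchyNaming ν) (padicNaming p) (f i)
  dom_eq : ∀ i, (f i).Dom = ⋃ j, V j
  subordinate : ∀ i, ∀ x ∈ ⋃ j, V j, (f i).val x ≠ 0 → x ∈ V i
  norm_le_one : ∀ i, ∀ x ∈ ⋃ j, V j, ‖(f i).val x‖ ≤ 1
  sum_eq_one : ∀ x ∈ ⋃ j, V j, ∑ᶠ i, (f i).val x = 1

/-- `h` is a homeomorphism of `A` onto an ultrametrically convex subset of `ℚ_p`. -/
structure IsHomeoOntoConvex (ν : ℕ → X) (A : Set X) (h : X →. ℚ_[p]) : Prop where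
  continuous : IsRelContinuous (cauchyNaming ν) (padicNaming p) h
  dom_eq : h.Dom = A
  isEmbedding : IsEmbedding (fun a : A => h.val (a : X))
  convex : UltrametricallyConvex (h.val '' A)

open Classical in
/-- The retraction: the identity on `A`, and `x ↦ h⁻¹ (∑ i, h (y i) * f i x)` off `A`. -/
noncomputable def retract [Nonempty X] (A : Set X) (y : ℕ → X) (f : ℕ → X →. ℚ_[p])
    (h : X →. ℚ_[p]) (x : X) : X :=
  if x ∈ A then x else Function.invFunOn h.val A (∑ᶠ i, h.val (y i) * (f i).val x)

/-- The tuples `(A; (V, y); f; h)` on which `θ` is defined. -/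
structure ThetaDom (ν : ℕ → X) (A : Set X) (V : ℕ → Set X) (y : ℕ → X) (f : ℕ → X →. ℚ_[p])
    (h : X →. ℚ_[p]) : Prop where
  nonempty : A.Nonempty
  ne_univ : A ≠ univ
  mem_systems : (V, y) ∈ DugundjiSystems ν
  compl_eq : (⋃ i, V i)ᶜ = A
  partition : IsPadicPartitionOfUnity ν V f
  homeo : IsHomeoOntoConvex ν A h

/-- The partial operator `θ (A; (V, y); f; h) = h ∘ r`. -/
noncomputable def theta [Nonempty X] (ν : ℕ → X) :
    Set X × ((ℕ → Set X) × (ℕ → X)) × (ℕ → X →. ℚ_[p]) × (X →. ℚ_[p]) →. (X → ℚ_[p]) :=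
  fun t => ⟨ThetaDom ν t.1 t.2.1.1 t.2.1.2 t.2.2.1 t.2.2.2,
    fun _ x => t.2.2.2.val (retract t.1 t.2.1.2 t.2.2.1 t.2.2.2 x)⟩

variable (p) in
/-- The representation
`[δ_range ⊓ δ_dist^>, δ₃, [δ_X → δ_K]_{Σ⁰₁(X)}^ω, [δ_X → δ_K]_{Π⁰₁(X)}]`. -/
def thetaInputNaming (ν : ℕ → X) :
    Naming (Set X × ((ℕ → Set X) × (ℕ → X)) × (ℕ → X →. ℚ_[p]) × (X →. ℚ_[p])) :=
  prodNaming (meetNaming (rangeNaming ν) (distNaming ν))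
    (prodNaming (dugundjiNaming ν)
      (prodNaming (seqNaming (pfunNaming (cauchyNaming ν) (padicNaming p) (openNaming ν)))
        (pfunNaming (cauchyNaming ν) (padicNaming p) (closedNaming ν))))

end MetricSpaces

/-!
Both for `x ∈ A` and for `x ∉ A`, the value `h (r x)` is a mean, with weights of norm at most one
and sum one, of values of `h` at points `a ∈ A` with `dist x a ≤ 2 * infDist x A`. In an
ultrametric field such a mean is within `ρ` of `d` as soon as all the averaged values are, and it
stays in every ultrametrically convex set containing them.

To approximate `h (r x)`, search in parallel for two kinds of evidence. If a ball of the given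
exhaustion of `Aᶜ` is seen to contain `x`, then finitely many known indices suffice, and the finite
sum is approximated termwise. If a realizer of `h` produces `d` from a prefix of a name of `x`, and
a point of `A` is found so close to `x` that this prefix also begins names of all points of `A`
within distance `2 * infDist x A` of `x`, then `d` is close to all values of `h` that are averaged.
The first search succeeds for `x ∉ A`, the second for `x ∈ A`, and each is sound for every `x`.
-/

namespace Baire

@[simp] theorem length_take (q : Baire) (k : ℕ) : (take q k).length = k := by simp [take]

theorem getElem?_take (q : Baire) (k i : ℕ) :
    (take q k)[i]? = if i < k then some (q i) else none := by
  simp only [take, List.getElem?_map]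
  split_ifs <;> simp_all

theorem getD_take {k i : ℕ} (q : Baire) (hi : i < k) : (take q k).getD i 0 = q i := by
  rw [List.getD_eq_getElem?_getD, getElem?_take, if_pos hi, Option.getD_some]

theorem take_take_of_le (q : Baire) {j k : ℕ} (h : j ≤ k) : (take q k).take j = take q j := by
  rw [take, ← List.map_take, List.take_range, min_eq_left h, take]

theorem take_eq_iff {q : Baire} {k : ℕ} {l : List ℕ} :
    take q k = l ↔ l.length = k ∧ ∀ i < k, q i = l.getD i 0 := by
  constructor
  · rintro rfl
    exact ⟨length_take q k, fun i hi => (getD_take q hi).symm⟩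
  · rintro ⟨rfl, h⟩
    refine List.ext_getElem (length_take q _) fun i _ hi => ?_
    rw [← List.getD_eq_getElem _ 0 hi, ← h i hi, ← List.getD_eq_getElem _ 0, getD_take q hi]

theorem query_congr {q q' : Baire} {k : ℕ} (n : ℕ) (h : ∀ i < k, q i = q' i) :
    query n q k = query n q' k := by
  have htake : take q k = take q' k :=
    take_eq_iff.2 ⟨length_take q' k, fun i hi => (h i hi).trans (getD_take q' hi).symm⟩
  rw [query, query, htake]

/-- The procedure with table `p` decides entry `n` of its output on input `q` exactly at
stage `k`, and the entry is `m`. -/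
def Decides (p q : Baire) (n k m : ℕ) : Prop :=
  p (query n q k) = m + 1 ∧ ∀ j < k, p (query n q j) = 0

theorem Decides.congr {p q q' : Baire} {n k m : ℕ} (hd : Decides p q n k m)
    (h : ∀ i < k, q i = q' i) : Decides p q' n k m := by
  refine ⟨?_, fun j hj => ?_⟩
  · rw [← query_congr n h, hd.1]
  · rw [← query_congr n fun i hi => h i (hi.trans hj), hd.2 j hj]

theorem exists_decides_of_mem_eta {p q r : Baire} (h : r ∈ eta p q) (n : ℕ) :
    ∃ k, Decides p q n k (r n) := by
  obtain ⟨hq, rfl⟩ := h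
  refine ⟨Nat.find (hq n), ?_, fun j hj => not_not.1 (Nat.find_min (hq n) hj)⟩
  exact (Nat.succ_pred_eq_of_ne_zero (Nat.find_spec (hq n))).symm

theorem eq_of_mem_eta_of_decides {p q r : Baire} (h : r ∈ eta p q) {n k m : ℕ}
    (hd : Decides p q n k m) : r n = m := by
  obtain ⟨hq, rfl⟩ := h
  have hfind : Nat.find (hq n) = k := by
    rw [Nat.find_eq_iff]
    exact ⟨by rw [hd.1]; exact m.succ_ne_zero, fun j hj => not_not.2 (hd.2 j hj)⟩
  simp only [eta, hfind, hd.1, Nat.add_sub_cancel]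

theorem mem_eta_of_decides {p q r : Baire} (h : ∀ n, ∃ k, Decides p q n k (r n)) :
    r ∈ eta p q := by
  have hdom : ∀ n, ∃ k, p (query n q k) ≠ 0 := fun n =>
    (h n).imp fun k hk => by rw [hk.1]; exact (r n).succ_ne_zero
  have hmem : (eta p q).get hdom ∈ eta p q := Part.get_mem _
  convert hmem
  funext n
  obtain ⟨k, hk⟩ := h n
  exact (eq_of_mem_eta_of_decides hmem hk).symm

theorem exists_mem_eta_of_forall_exists_ne_zero {p q : Baire}
    (h : ∀ n, ∃ k, p (query n q k) ≠ 0) :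
    ∃ r ∈ eta p q, ∀ n, ∃ k, p (query n q k) = r n + 1 :=
  ⟨(eta p q).get h, Part.get_mem _, fun n =>
    (exists_decides_of_mem_eta (Part.get_mem _) n).imp fun _ hk => hk.1⟩

/-- The interleaving pairing `⟨s, q⟩ = (s₀, q₀, s₁, q₁, …)`. -/
def pair (s q : Baire) : Baire := fun n => bif n.bodd then q n.div2 else s n.div2

@[simp] theorem fst_pair (s q : Baire) : fst (pair s q) = s := by
  funext n
  simp [fst, pair]

@[simp] theorem snd_pair (s q : Baire) : snd (pair s q) = q := by
  funext n
  simp [snd, pair]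

end Baire

/-! ### Computability of functions on the natural numbers -/

attribute [local fun_prop] Computable Computable.id Computable.const Computable.comp Computable.fst
  Computable.snd Computable.pair Computable.unpair Computable.nat_bodd Computable.nat_div2
  Computable.encode Computable.decode Computable.list_length Computable.cond

section

variable {α β : Type*} [Primcodable α] [Primcodable β] {f g : α → ℕ} {u v : α → Bool}
  {l : α → List ℕ}

theorem computable_add (hf : Computable f) (hg : Computable g) : Computable fun a => f a + g a :=
  Primrec.nat_add.to_comp.comp hf hg

theorem computable_sub (hf : Computable f) (hg : Computable g) : Computable fun a => f a - g a :=
  Primrec.nat_sub.to_comp.comp hf hg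

theorem computable_mul (hf : Computable f) (hg : Computable g) : Computable fun a => f a * g a :=
  Primrec.nat_mul.to_comp.comp hf hg

theorem computable_pow (hf : Computable f) (hg : Computable g) : Computable fun a => f a ^ g a :=
  (Primrec₂.unpaired'.1 Nat.Primrec.pow).to_comp.comp hf hg

theorem computable_natPair (hf : Computable f) (hg : Computable g) :
    Computable fun a => Nat.pair (f a) (g a) :=
  Primrec₂.natPair.to_comp.comp hf hg

theorem computable_decide_lt (hf : Computable f) (hg : Computable g) :
    Computable fun a => decide (f a < g a) :=
  Primrec.nat_lt.decide.to_comp.comp hf hg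

theorem computable_decide_le (hf : Computable f) (hg : Computable g) :
    Computable fun a => decide (f a ≤ g a) :=
  Primrec.nat_le.decide.to_comp.comp hf hg

theorem computable_decide_eq {f g : α → β} [DecidableEq β]
    (hf : Computable f) (hg : Computable g) :
    Computable fun a => decide (f a = g a) :=
  Primrec.eq.decide.to_comp.comp hf hg

theorem computable_not (hu : Computable u) : Computable fun a => !u a :=
  Primrec.not.to_comp.comp hu

theorem computable_and (hu : Computable u) (hv : Computable v) : Computable fun a => u a && v a :=
  Primrec.and.to_comp.comp hu hv

theorem computable_or (hu : Computable u) (hv : Computable v) : Computable fun a => u a || v a :=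
  Primrec.or.to_comp.comp hu hv

theorem computable_getD (hl : Computable l) (hf : Computable f) :
    Computable fun a => (l a).getD (f a) 0 :=
  (Primrec.list_getD 0).to_comp.comp hl hf

theorem computable_take (hl : Computable l) (hf : Computable f) :
    Computable fun a => (l a).take (f a) :=
  Primrec.list_take.to_comp.comp hf hl

theorem computable_idxOf {l : α → List Bool} (hu : Computable u) (hl : Computable l) :
    Computable fun a => (l a).idxOf (u a) :=
  Primrec.list_idxOf.to_comp.comp hu hl

theorem computable_map_range {f : α × ℕ → β} (hf : Computable f) (hg : Computable g) :
    Computable fun a => (List.range (g a)).map fun i => f (a, i) := by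
  have hstep : Computable₂ fun a (z : ℕ × List β) => z.2 ++ [f (a, z.1)] :=
    Computable.list_concat.comp (by fun_prop) (hf.comp (by fun_prop))
  refine (Computable.nat_rec (f := g) (g := fun _ : α => ([] : List β)) hg
    (Computable.const []) hstep).of_eq fun a => ?_
  induction g a with
  | zero => rfl
  | succ n ih => simp only [List.range_succ, List.map_append, List.map_singleton, ← ih]

end

attribute [local fun_prop] computable_add computable_sub computable_mul computable_pow
  computable_natPair computable_decide_lt computable_decide_le computable_decide_eq computable_and
  computable_or computable_getD computable_take

section

variable {α : Type*} [Primcodable α] {g : α → ℕ}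

theorem computable_decide_forall_lt {u : α × ℕ → Bool} (hu : Computable u) (hg : Computable g) :
    Computable fun a => decide (∀ i < g a, u (a, i) = true) := by
  refine (computable_decide_le hg (computable_idxOf (Computable.const false)
    (computable_map_range hu hg))).of_eq fun a => ?_
  rw [decide_eq_decide, ← not_lt]
  have : ((List.range (g a)).map fun i => u (a, i)).length = g a := by simp
  nth_rw 2 [← this]
  rw [List.idxOf_lt_length_iff]
  simp

theorem computable_decide_exists_lt {u : α × ℕ → Bool} (hu : Computable u) (hg : Computable g) :
    Computable fun a => decide (∃ i < g a, u (a, i) = true) := by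
  refine (computable_not (computable_decide_forall_lt (computable_not hu) hg)).of_eq fun a => ?_
  rw [← decide_not, decide_eq_decide]
  simp only [not_forall, exists_prop, Bool.not_eq_true', Bool.not_eq_false]

end

/-! ### Semidecidable relations -/

section

variable {α β : Type*} [Primcodable α] [Primcodable β]

/-- `R a t` is semidecidable, uniformly in `a` and relative to the oracle `t`: a recursive test
accepts `a` and a prefix of `t` only if `R a t` holds, and if `R a t` holds then it accepts
`a` together with all sufficiently long prefixes of `t`. -/
def IsSemidecidable (R : α → Baire → Prop) : Prop :=
  ∃ f : α × List ℕ → Bool, Computable f ∧ ∀ a t,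
    (∀ k, f (a, take t k) = true → R a t) ∧ (R a t → ∀ᶠ k in atTop, f (a, take t k) = true)

/-- `F a t` is the subsequence of the oracle `t` along recursive indices that depend recursively
on the parameter `a`. -/
def IsReindexing (F : α → Baire → Baire) : Prop :=
  ∃ e : α × ℕ → ℕ, Computable e ∧ ∀ a t i, F a t i = t (e (a, i))

namespace IsReindexing

variable {F : α → Baire → Baire}

theorem id : IsReindexing fun (_ : α) t => t :=
  ⟨fun x => x.2, by fun_prop, fun _ _ _ => rfl⟩

theorem reindex {g : α × ℕ → ℕ} (hF : IsReindexing F) (hg : Computable g) :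
    IsReindexing fun a t i => F a t (g (a, i)) := by
  obtain ⟨e, he, hF⟩ := hF
  exact ⟨fun x => e (x.1, g x), by fun_prop, fun a t i => hF a t _⟩

theorem fst (hF : IsReindexing F) : IsReindexing fun a t => fst (F a t) :=
  hF.reindex (g := fun x => 2 * x.2) (by fun_prop)

theorem snd (hF : IsReindexing F) : IsReindexing fun a t => snd (F a t) :=
  hF.reindex (g := fun x => 2 * x.2 + 1) (by fun_prop)

theorem comp {g : α → ℕ} (hF : IsReindexing F) (hg : Computable g) :
    IsReindexing fun a t => comp (F a t) (g a) :=
  hF.reindex (g := fun x => Nat.pair (g x.1) x.2) (by fun_prop)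

theorem param {g : β → α} (hF : IsReindexing F) (hg : Computable g) :
    IsReindexing fun b => F (g b) := by
  obtain ⟨e, he, hF⟩ := hF
  exact ⟨fun x => e (g x.1, x.2), by fun_prop, fun b => hF (g b)⟩

end IsReindexing

namespace IsSemidecidable

variable {R R' : α → Baire → Prop}

theorem comp {R : β → Baire → Prop} {g : α → β} (hR : IsSemidecidable R) (hg : Computable g) :
    IsSemidecidable fun a => R (g a) := by
  obtain ⟨f, hf, hR⟩ := hR
  exact ⟨fun x => f (g x.1, x.2), by fun_prop, fun a => hR (g a)⟩

theorem of_computable {P : α → Prop} [DecidablePred P] (hP : Computable fun a => decide (P a)) :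
    IsSemidecidable fun a _ => P a :=
  ⟨fun x => decide (P x.1), hP.comp Computable.fst, fun _ _ =>
    ⟨fun _ h => of_decide_eq_true h, fun h => .of_forall fun _ => decide_eq_true h⟩⟩

theorem and (hR : IsSemidecidable R) (hR' : IsSemidecidable R') :
    IsSemidecidable fun a t => R a t ∧ R' a t := by
  obtain ⟨f, hf, hR⟩ := hR
  obtain ⟨f', hf', hR'⟩ := hR'
  refine ⟨fun x => f x && f' x, by fun_prop, fun a t => ⟨fun k h => ?_, fun h => ?_⟩⟩
  · obtain ⟨h, h'⟩ := Bool.and_eq_true_iff.1 h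
    exact ⟨(hR a t).1 k h, (hR' a t).1 k h'⟩
  · filter_upwards [(hR a t).2 h.1, (hR' a t).2 h.2] with k hk hk'
    exact Bool.and_eq_true_iff.2 ⟨hk, hk'⟩

theorem or (hR : IsSemidecidable R) (hR' : IsSemidecidable R') :
    IsSemidecidable fun a t => R a t ∨ R' a t := by
  obtain ⟨f, hf, hR⟩ := hR
  obtain ⟨f', hf', hR'⟩ := hR'
  refine ⟨fun x => f x || f' x, by fun_prop, fun a t => ⟨fun k h => ?_, ?_⟩⟩
  · exact (Bool.or_eq_true_iff.1 h).imp ((hR a t).1 k) ((hR' a t).1 k)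
  · rintro (h | h)
    · exact ((hR a t).2 h).mono fun k hk => Bool.or_eq_true_iff.2 (.inl hk)
    · exact ((hR' a t).2 h).mono fun k hk => Bool.or_eq_true_iff.2 (.inr hk)

theorem exists_right {R : α → β → Baire → Prop}
    (hR : IsSemidecidable fun x : α × β => R x.1 x.2) :
    IsSemidecidable fun a t => ∃ b, R a b t := by
  obtain ⟨f, hf, hR⟩ := hR
  let u : (α × List ℕ) × ℕ → Bool := fun x =>
    ((Encodable.decode x.2 : Option β).map fun b => f ((x.1.1, b), x.1.2)).getD false
  have hu : Computable u :=
    Computable.option_getD (Computable.option_map (by fun_prop) (by unfold Computable₂; fun_prop))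
      (by fun_prop)
  refine ⟨fun x => decide (∃ i < x.2.length, u (x, i) = true),
    computable_decide_exists_lt hu (by fun_prop), fun a t => ⟨fun k h => ?_, ?_⟩⟩
  · obtain ⟨i, -, hi⟩ := of_decide_eq_true h
    rcases hb : (Encodable.decode i : Option β) with _ | b
    · simp [u, hb] at hi
    · exact ⟨b, (hR (a, b) t).1 k (by simpa [u, hb] using hi)⟩
  · rintro ⟨b, hb⟩
    filter_upwards [(hR (a, b) t).2 hb, eventually_gt_atTop (Encodable.encode b)] with k hk hbk
    exact decide_eq_true ⟨Encodable.encode b, by simpa using hbk, by simpa [u] using hk⟩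

theorem forall_lt {R : α → ℕ → Baire → Prop} {g : α → ℕ}
    (hR : IsSemidecidable fun x : α × ℕ => R x.1 x.2) (hg : Computable g) :
    IsSemidecidable fun a t => ∀ i < g a, R a i t := by
  obtain ⟨f, hf, hR⟩ := hR
  refine ⟨fun x => decide (∀ i < g x.1, f ((x.1, i), x.2) = true),
    computable_decide_forall_lt (u := fun y : (α × List ℕ) × ℕ => f ((y.1.1, y.2), y.1.2))
      (by fun_prop) (by fun_prop), fun a t => ⟨fun k h i hi => ?_, fun h => ?_⟩⟩
  · exact (hR (a, i) t).1 k (of_decide_eq_true h i hi)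
  · have hev : ∀ᶠ k in atTop, ∀ i ∈ Iio (g a), f ((a, i), take t k) = true :=
      (eventually_all_finite (finite_Iio (g a))).2 fun i hi => (hR (a, i) t).2 (h i hi)
    exact hev.mono fun k hk => decide_eq_true hk

theorem oracle_eq {F : α → Baire → Baire} {g v : α → ℕ} (hF : IsReindexing F)
    (hg : Computable g) (hv : Computable v) : IsSemidecidable fun a t => F a t (g a) = v a := by
  obtain ⟨e, he, hF⟩ := hF
  refine ⟨fun x => decide (e (x.1, g x.1) < x.2.length) &&
    decide (x.2.getD (e (x.1, g x.1)) 0 = v x.1), by fun_prop, fun a t => ?_⟩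
  simp only [hF, length_take, Bool.and_eq_true, decide_eq_true_eq]
  refine ⟨fun k h => (getD_take t h.1).symm.trans h.2, fun h => ?_⟩
  filter_upwards [eventually_gt_atTop (e (a, g a))] with k hk
  exact ⟨hk, (getD_take t hk).trans h⟩

theorem take_eq {F : α → Baire → Baire} {g : α → ℕ} {l : α → List ℕ} (hF : IsReindexing F)
    (hg : Computable g) (hl : Computable l) :
    IsSemidecidable fun a t => take (F a t) (g a) = l a := by
  simp only [take_eq_iff]
  exact (of_computable (by fun_prop)).and
    (forall_lt (oracle_eq (hF.param Computable.fst) (by fun_prop) (by fun_prop)) hg)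

theorem decides {F G : α → Baire → Baire} {n k m : α → ℕ} (hF : IsReindexing F)
    (hG : IsReindexing G) (hn : Computable n) (hk : Computable k) (hm : Computable m) :
    IsSemidecidable fun a t => Decides (F a t) (G a t) (n a) (k a) (m a) := by
  have hprefix : ∀ a t, Decides (F a t) (G a t) (n a) (k a) (m a) ↔
      ∃ l : List ℕ, take (G a t) (k a) = l ∧ F a t (Encodable.encode (n a, l)) = m a + 1 ∧
        ∀ j < k a, F a t (Encodable.encode (n a, l.take j)) = 0 := by
    intro a t
    simp only [Decides, query, exists_eq_left']
    refine and_congr_right fun _ => forall₂_congr fun j hj => ?_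
    rw [take_take_of_le _ hj.le]
  simp only [hprefix]
  have hpref : IsSemidecidable fun (x : α × List ℕ) t => take (G x.1 t) (k x.1) = x.2 :=
    take_eq (hG.param Computable.fst) (by fun_prop) (by fun_prop)
  have hvalue : IsSemidecidable fun (x : α × List ℕ) t =>
      F x.1 t (Encodable.encode (n x.1, x.2)) = m x.1 + 1 :=
    oracle_eq (hF.param Computable.fst) (by fun_prop) (by fun_prop)
  have hpending : IsSemidecidable fun (x : α × List ℕ) t =>
      ∀ j < k x.1, F x.1 t (Encodable.encode (n x.1, x.2.take j)) = 0 :=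
    forall_lt (oracle_eq (hF.param (by fun_prop)) (by fun_prop) (by fun_prop)) (by fun_prop)
  exact exists_right (hpref.and (hvalue.and hpending))

end IsSemidecidable

end

/-! ### Computable realizers -/

theorem exists_computable_bounded_search {α : Type*} [Primcodable α] {u : α × ℕ → Bool}
    {g : α → ℕ} (hu : Computable u) (hg : Computable g) :
    ∃ φ : α → ℕ, Computable φ ∧ ∀ a, ((∃ i < g a, u (a, i) = true) → φ a ≠ 0) ∧
      ∀ m, φ a = m + 1 → u (a, m) = true := by
  let least : α → ℕ := fun a => ((List.range (g a)).map fun i => u (a, i)).idxOf true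
  have hleast : Computable least :=
    computable_idxOf (Computable.const true) (computable_map_range hu hg)
  refine ⟨fun a => bif u (a, least a) then least a + 1 else 0, by fun_prop, fun a => ⟨?_, ?_⟩⟩
  · rintro ⟨i, hi, hui⟩
    have hmem : true ∈ (List.range (g a)).map fun i => u (a, i) :=
      List.mem_map.2 ⟨i, List.mem_range.2 hi, hui⟩
    have hfound : u (a, least a) = true := by
      simpa only [List.getElem_map, List.getElem_range] using
        List.getElem_idxOf (List.idxOf_lt_length_of_mem hmem)
    simp only [hfound, cond_true]
    exact Nat.succ_ne_zero _
  · intro m hm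
    cases hfound : u (a, least a) with
    | false => simp [hfound] at hm
    | true =>
      have hleast_eq : least a = m := by simpa [hfound] using hm
      rwa [hleast_eq] at hfound

theorem exists_computable_query {φ : ℕ × List ℕ → ℕ} (hφ : Computable φ) :
    ∃ c : Baire, Computable c ∧ ∀ n q k, c (query n q k) = φ (n, take q k) := by
  refine ⟨fun z => φ ((Encodable.decode z).getD (0, [])),
    hφ.comp (Computable.option_getD (by fun_prop) (Computable.const (0, []))), fun n q k => ?_⟩
  simp [query]

theorem IsSemidecidable.exists_computable_choice {R : ℕ × ℕ → Baire → Prop}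
    (hR : IsSemidecidable R) :
    ∃ c : Baire, Computable c ∧ ∀ t, (∀ n, ∃ d, R (n, d) t) → ∃ r ∈ eta c t, ∀ n, R (n, r n) t := by
  obtain ⟨f, hf, hR⟩ := hR
  obtain ⟨φ, hφ, hsearch⟩ := exists_computable_bounded_search
    (u := fun x : (ℕ × List ℕ) × ℕ => f ((x.1.1, x.2), x.1.2)) (g := fun z => z.2.length)
    (by fun_prop) (by fun_prop)
  obtain ⟨c, hc, hcφ⟩ := exists_computable_query hφ
  refine ⟨c, hc, fun t ht => ?_⟩
  have hdefined : ∀ n, ∃ k, c (query n t k) ≠ 0 := fun n => by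
    obtain ⟨d, hd⟩ := ht n
    obtain ⟨k, hk, hdk⟩ := (((hR (n, d) t).2 hd).and (eventually_gt_atTop d)).exists
    exact ⟨k, by rw [hcφ]; exact (hsearch _).1 ⟨d, by simpa using hdk, hk⟩⟩
  obtain ⟨r, hr, hrc⟩ := exists_mem_eta_of_forall_exists_ne_zero hdefined
  refine ⟨r, hr, fun n => ?_⟩
  obtain ⟨k, hk⟩ := hrc n
  exact (hR (n, r n) t).1 k ((hsearch _).2 _ ((hcφ n t k).symm.trans hk))

theorem exists_computable_eta_of_prefix {φ : ℕ × List ℕ → ℕ} {N : ℕ → ℕ} (hφ : Computable φ)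
    (hN : Computable N) :
    ∃ c : Baire, Computable c ∧ ∀ s, (fun m => φ (m, take s (N m))) ∈ eta c s := by
  obtain ⟨c, hc, hcφ⟩ := exists_computable_query (φ := fun z =>
    bif decide (N z.1 ≤ z.2.length) then φ (z.1, z.2.take (N z.1)) + 1 else 0) (by fun_prop)
  refine ⟨c, hc, fun s => mem_eta_of_decides fun m => ⟨N m, ?_, fun j hj => ?_⟩⟩
  · simp only [hcφ, length_take, le_refl, decide_true, cond_true, take_take_of_le]
  · simp only [hcφ, length_take, decide_eq_false hj.not_ge, cond_false]

/-- The length-`k` prefix of `⟨s, q⟩`, computed from the length-`k` prefixes of `s` and `q`. -/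
def interleave (l l' : List ℕ) : List ℕ :=
  (List.range l'.length).map fun i => bif i.bodd then l'.getD i.div2 0 else l.getD i.div2 0

theorem interleave_take (s q : Baire) (k : ℕ) :
    interleave (take s k) (take q k) = take (pair s q) k := by
  rw [interleave, length_take]
  refine List.map_congr_left fun i hi => ?_
  have hik : i.div2 < k := (Nat.div2_val i ▸ Nat.div_le_self i 2).trans_lt (List.mem_range.1 hi)
  simp only [pair, getD_take _ hik]

theorem computable_interleave {α : Type*} [Primcodable α] {l l' : α → List ℕ}
    (hl : Computable l) (hl' : Computable l') : Computable fun a => interleave (l a) (l' a) :=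
  computable_map_range (f := fun x : α × ℕ =>
    bif x.2.bodd then (l' x.1).getD x.2.div2 0 else (l x.1).getD x.2.div2 0)
    (by fun_prop) (by fun_prop)

theorem exists_computable_curry {c : ℕ → ℕ} (hc : Computable c) :
    ∃ c' : Baire, Computable c' ∧ ∀ s, ∃ e ∈ eta c' s, ∀ q r,
      r ∈ eta c (pair s q) → r ∈ eta e q := by
  let code : ℕ → ℕ × List ℕ := fun m => (Encodable.decode m).getD (0, [])
  have hcode : Computable code :=
    Computable.option_getD (by fun_prop) (Computable.const (0, []))
  obtain ⟨c', hc', he⟩ := exists_computable_eta_of_prefix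
    (φ := fun z => c (Encodable.encode ((code z.1).1, interleave z.2 (code z.1).2)))
    (N := fun m => (code m).2.length)
    (hc.comp (Computable.encode.comp
      (Computable.pair (by fun_prop) (computable_interleave (by fun_prop) (by fun_prop)))))
    (by fun_prop)
  refine ⟨c', hc', fun s => ⟨_, he s, fun q r hr => mem_eta_of_decides fun n => ?_⟩⟩
  obtain ⟨k, hk⟩ := exists_decides_of_mem_eta hr n
  have hquery : ∀ j, c (Encodable.encode ((code (query n q j)).1,
      interleave (take s (code (query n q j)).2.length) (code (query n q j)).2)) =
      c (query n (pair s q) j) := fun j => by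
    simp [code, query, interleave_take]
  exact ⟨k, (hquery k).trans hk.1, fun j hj => (hquery j).trans (hk.2 j hj)⟩

theorem IsComputableMap.curry {X Y Z : Type*} {δX : Naming X} {δY : Naming Y} {δZ : Naming Z}
    {θ : X →. (Y → Z)}
    (hθ : IsComputableMap (prodNaming δX δY) δZ fun z => (θ z.1).map fun g => g z.2) :
    IsComputableMap δX (funNaming δY δZ) θ := by
  obtain ⟨c, hc, hcθ⟩ := hθ
  obtain ⟨c', hc', hcurry⟩ := exists_computable_curry hc
  refine ⟨c', hc', fun s x g hs hg => ?_⟩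
  obtain ⟨e, he, heq⟩ := hcurry s
  refine ⟨e, he, fun q y z hq hz => ?_⟩
  obtain rfl : z = g y := Part.mem_some_iff.1 hz
  obtain ⟨r, hr, hrz⟩ := hcθ (pair s q) (x, y) (g y)
    (by simpa only [prodNaming, fst_pair, snd_pair] using ⟨hs, hq⟩) (Part.mem_map _ hg)
  exact ⟨r, heq q r hr, hrz⟩

/-! ### Cauchy names -/

theorem val_mem_of_mem_dom {X Y : Type*} [Zero Y] {f : X →. Y} {x : X} (hx : x ∈ f.Dom) :
    f.val x ∈ f x := by
  classical
  rw [PFun.val, Part.getOrElse_of_dom _ hx]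
  exact Part.get_mem _

section CauchyNames

variable {X Y : Type*} [MetricSpace X] [MetricSpace Y] {ν : ℕ → X} {μ : ℕ → Y}

theorem half_pow_le_half_pow {m n : ℕ} (h : m ≤ n) : (1 / 2 : ℝ) ^ n ≤ (1 / 2) ^ m :=
  pow_le_pow_of_le_one (by norm_num) (by norm_num) h

theorem cauchyNaming.dist_le {q : Baire} {x : X} (h : cauchyNaming ν q x) (i : ℕ) :
    dist (ν (q i)) x ≤ (1 / 2 : ℝ) ^ i := by
  refine le_of_tendsto (tendsto_const_nhds.dist h.2) ?_
  filter_upwards [eventually_ge_atTop i] with j hj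
  simpa only [min_eq_left hj] using (h.1 i j).le

theorem cauchyNaming.of_dist_lt {q : Baire} {x : X}
    (h : ∀ i, dist (ν (q i)) x < (1 / 2 : ℝ) ^ (i + 1)) : cauchyNaming ν q x := by
  refine ⟨fun i j => ?_, tendsto_iff_dist_tendsto_zero.2 (squeeze_zero (fun _ => dist_nonneg)
    (fun i => (h i).le) ?_)⟩
  · calc dist (ν (q i)) (ν (q j)) ≤ dist (ν (q i)) x + dist (ν (q j)) x :=
          dist_triangle_right _ _ _
      _ < (1 / 2) ^ (i + 1) + (1 / 2) ^ (j + 1) := add_lt_add (h i) (h j)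
      _ ≤ (1 / 2) ^ (min i j + 1) + (1 / 2) ^ (min i j + 1) := add_le_add
          (half_pow_le_half_pow (by omega)) (half_pow_le_half_pow (by omega))
      _ = (1 / 2) ^ min i j := by ring
  · exact (tendsto_pow_atTop_nhds_zero_of_lt_one (by norm_num) (by norm_num)).comp
      (tendsto_add_atTop_nat 1)

theorem cauchyNaming.shift {q : Baire} {x : X} (h : cauchyNaming ν q x) :
    cauchyNaming ν (fun i => q (i + 1)) x :=
  ⟨fun _ _ => (h.1 _ _).trans_le (half_pow_le_half_pow (by omega)),
    h.2.comp (tendsto_add_atTop_nat 1)⟩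

theorem exists_forall_dist_lt (hν : DenseRange ν) (x : X) {b : ℕ → ℝ} (hb : ∀ i, 0 < b i) :
    ∃ q : Baire, ∀ i, dist (ν (q i)) x < b i := by
  choose q hq using fun i => hν.exists_dist_lt x (hb i)
  exact ⟨q, fun i => by rw [dist_comm]; exact hq i⟩

theorem exists_cauchyNaming_dist_lt (hν : DenseRange ν) (x : X) :
    ∃ q : Baire, cauchyNaming ν q x ∧ ∀ i, dist (ν (q i)) x < (1 / 2 : ℝ) ^ (i + 1) := by
  obtain ⟨q, hq⟩ := exists_forall_dist_lt hν x (b := fun i => (1 / 2 : ℝ) ^ (i + 1))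
    fun i => by positivity
  exact ⟨q, .of_dist_lt hq, hq⟩

theorem exists_pos_forall_lt_add_lt {k : ℕ} {a b : ℕ → ℝ} (h : ∀ i < k, a i < b i) :
    ∃ ε > 0, ∀ i < k, a i + ε < b i := by
  have hlt : ∀ i ∈ Iio k, ∀ᶠ ε in 𝓝[>] (0 : ℝ), a i + ε < b i := fun i hi => by
    have hcont : Tendsto (fun ε => a i + ε) (𝓝[>] 0) (𝓝 (a i + 0)) :=
      (continuous_const.add continuous_id).continuousWithinAt.tendsto
    exact hcont.eventually_lt_const (by simpa using h i hi)
  exact (((eventually_all_finite (finite_Iio k)).2 hlt).and self_mem_nhdsWithin).exists.imp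
    fun ε hε => ⟨hε.2, hε.1⟩

theorem exists_cauchyNaming_eq_of_lt (hν : DenseRange ν) {q : Baire} {k : ℕ} {y : X}
    (hq : ∀ i < k, ∀ j < k, dist (ν (q i)) (ν (q j)) < (1 / 2 : ℝ) ^ (min i j))
    (hy : ∀ i < k, dist (ν (q i)) y < (1 / 2 : ℝ) ^ i) :
    ∃ q' : Baire, cauchyNaming ν q' y ∧ ∀ i < k, q' i = q i := by
  obtain ⟨ε, hε, hεk⟩ := exists_pos_forall_lt_add_lt hy
  obtain ⟨a, ha⟩ := exists_forall_dist_lt hν y (b := fun i => min ε ((1 / 2 : ℝ) ^ (i + 1)))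
    fun i => lt_min hε (by positivity)
  have hac : cauchyNaming ν a y := .of_dist_lt fun i => (ha i).trans_le (min_le_right _ _)
  have hqa : ∀ i < k, ∀ j, dist (ν (q i)) (ν (a j)) < (1 / 2 : ℝ) ^ i := fun i hi j =>
    calc dist (ν (q i)) (ν (a j)) ≤ dist (ν (q i)) y + dist (ν (a j)) y :=
          dist_triangle_right _ _ _
      _ < dist (ν (q i)) y + ε := by gcongr; exact (ha j).trans_le (min_le_left _ _)
      _ < (1 / 2) ^ i := hεk i hi
  refine ⟨fun i => if i < k then q i else a i, ⟨fun i j => ?_, hac.2.congr' ?_⟩,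
    fun i hi => if_pos hi⟩
  · beta_reduce
    split_ifs with hi hj hj
    · exact hq i hi j hj
    · rw [min_eq_left (by omega)]
      exact hqa i hi j
    · rw [min_eq_right (by omega), dist_comm]
      exact hqa j hj i
    · exact hac.1 i j
  · filter_upwards [eventually_ge_atTop k] with i hi
    rw [if_neg hi.not_gt]

namespace Realizes

variable {f : X →. Y} {P q : Baire} {x y : X} {v : Y} {n k m : ℕ}

theorem exists_decides (hP : Realizes (cauchyNaming ν) (cauchyNaming μ) (eta P) f)
    (hq : cauchyNaming ν q x) (hv : v ∈ f x) (n : ℕ) : ∃ k m, Decides P q n k m := by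
  obtain ⟨r, hr, -⟩ := hP q x v hq hv
  exact (exists_decides_of_mem_eta hr n).imp fun k hk => ⟨_, hk⟩

theorem dist_le_of_decides (hP : Realizes (cauchyNaming ν) (cauchyNaming μ) (eta P) f)
    (hq : cauchyNaming ν q x) (hv : v ∈ f x) (hd : Decides P q n k m) :
    dist (μ m) v ≤ (1 / 2 : ℝ) ^ n := by
  obtain ⟨r, hr, hrv⟩ := hP q x v hq hv
  rw [← eq_of_mem_eta_of_decides hr hd]
  exact hrv.dist_le n

theorem dist_le_of_decides_of_lt (hP : Realizes (cauchyNaming ν) (cauchyNaming μ) (eta P) f)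
    (hν : DenseRange ν) (hq : cauchyNaming ν q x) (hd : Decides P q n k m)
    (hy : ∀ i < k, dist (ν (q i)) y < (1 / 2 : ℝ) ^ i) (hv : v ∈ f y) :
    dist (μ m) v ≤ (1 / 2 : ℝ) ^ n := by
  obtain ⟨q', hq', h⟩ := exists_cauchyNaming_eq_of_lt hν (fun i _ j _ => hq.1 i j) hy
  exact hP.dist_le_of_decides hq' hv (hd.congr fun i hi => (h i hi).symm)

end Realizes

theorem IsRelContinuous.continuousOn_val [Zero Y] (hν : DenseRange ν) {f : X →. Y}
    (hf : IsRelContinuous (cauchyNaming ν) (cauchyNaming μ) f) : ContinuousOn f.val f.Dom := by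
  obtain ⟨P, hP⟩ := hf
  intro x hx
  refine Metric.tendsto_nhds.2 fun ε hε => ?_
  obtain ⟨n, hn⟩ := exists_pow_lt_of_lt_one (half_pos hε) (show (1 / 2 : ℝ) < 1 by norm_num)
  obtain ⟨q, hq, hqx⟩ := exists_cauchyNaming_dist_lt hν x
  obtain ⟨k, m, hd⟩ := hP.exists_decides hq (val_mem_of_mem_dom hx) n
  have hmx := hP.dist_le_of_decides hq (val_mem_of_mem_dom hx) hd
  have hpos : (0 : ℝ) < (1 / 2) ^ (k + 1) := by positivity
  filter_upwards [self_mem_nhdsWithin, mem_nhdsWithin_of_mem_nhds (Metric.ball_mem_nhds x hpos)]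
    with y hy hyx
  have hqy : ∀ i < k, dist (ν (q i)) y < (1 / 2 : ℝ) ^ i := fun i hi =>
    calc dist (ν (q i)) y ≤ dist (ν (q i)) x + dist x y := dist_triangle _ _ _
      _ < (1 / 2) ^ (i + 1) + (1 / 2) ^ (i + 1) := by
          refine add_lt_add (hqx i) ?_
          rw [dist_comm]
          exact (Metric.mem_ball.1 hyx).trans_le (half_pow_le_half_pow (by omega))
      _ = (1 / 2) ^ i := by ring
  have hmy := hP.dist_le_of_decides_of_lt hν hq hd hqy (val_mem_of_mem_dom hy)
  linarith [dist_triangle_left (f.val y) (f.val x) (μ m)]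

end CauchyNames

theorem isComputableMap_of_isSemidecidable {X Y : Type*} [MetricSpace Y] {δ : Naming X}
    {μ : ℕ → Y} {f : X →. Y} {R : ℕ × ℕ → Baire → Prop} (hR : IsSemidecidable R)
    (hexists : ∀ t x y, δ t x → y ∈ f x → ∀ n, ∃ d, R (n, d) t)
    (hdist : ∀ t x y, δ t x → y ∈ f x → ∀ n d, R (n, d) t → dist (μ d) y ≤ (1 / 2 : ℝ) ^ n) :
    IsComputableMap δ (cauchyNaming μ) f := by
  have hshift : IsSemidecidable fun (x : ℕ × ℕ) t => R (x.1 + 2, x.2) t :=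
    hR.comp (g := fun x : ℕ × ℕ => (x.1 + 2, x.2)) (by fun_prop)
  obtain ⟨c, hc, hchoice⟩ := hshift.exists_computable_choice
  refine ⟨c, hc, fun t x y hx hy => ?_⟩
  obtain ⟨r, hr, hrR⟩ := hchoice t fun n => hexists t x y hx hy (n + 2)
  refine ⟨r, hr, .of_dist_lt fun n => (hdist t x y hx hy _ _ (hrR n)).trans_lt ?_⟩
  exact pow_lt_pow_right_of_lt_one₀ (by norm_num) (by norm_num) (by omega)

/-! ### Computable rational-valued functions -/

theorem ratNum_surjective : Function.Surjective ratNum := fun q => by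
  refine ⟨Nat.pair (Nat.pair q.num.toNat (-q.num).toNat) (q.den - 1), ?_⟩
  have hnum : (q.num.toNat : ℤ) - ((-q.num).toNat : ℤ) = q.num := by omega
  have hnum' : (q.num.toNat : ℚ) - ((-q.num).toNat : ℚ) = q.num := by exact_mod_cast hnum
  simp only [ratNum, Nat.unpair_pair, Nat.cast_pred q.pos, hnum', sub_add_cancel, Rat.num_div_den]

theorem ratNum_lt_ratNum_iff {a b : ℕ} :
    ratNum a < ratNum b ↔
      a.unpair.1.unpair.1 * (b.unpair.2 + 1) + b.unpair.1.unpair.2 * (a.unpair.2 + 1) <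
        b.unpair.1.unpair.1 * (a.unpair.2 + 1) + a.unpair.1.unpair.2 * (b.unpair.2 + 1) := by
  simp only [ratNum]
  rw [div_lt_div_iff₀ (by positivity) (by positivity), ← Nat.cast_lt (α := ℚ)]
  push_cast
  constructor <;> intro h <;> linarith

section

variable {α : Type*} [Primcodable α]

/-- `f` is computable as a map to `ℚ`, with respect to the standard numbering of `ℚ`. -/
def IsComputableRat (f : α → ℚ) : Prop :=
  ∃ c : α → ℕ, Computable c ∧ ∀ a, ratNum (c a) = f a

namespace IsComputableRat

variable {f g : α → ℚ} {c d e n : α → ℕ}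

theorem of_ratNum (hc : Computable c) : IsComputableRat fun a => ratNum (c a) :=
  ⟨c, hc, fun _ => rfl⟩

theorem of_eq_div (hc : Computable c) (hd : Computable d) (he : Computable e)
    (hf : ∀ a, f a = (c a - d a) / (e a + 1)) : IsComputableRat f :=
  ⟨fun a => Nat.pair (Nat.pair (c a) (d a)) (e a), by fun_prop, fun a => by
    simp [ratNum, hf]⟩

theorem of_posRatNum (hc : Computable c) : IsComputableRat fun a => posRatNum (c a) :=
  of_eq_div (c := fun a => (c a).unpair.1 + 1) (d := fun _ => 0) (e := fun a => (c a).unpair.2)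
    (by fun_prop) (by fun_prop) (by fun_prop) fun a => by simp [posRatNum]

theorem half_pow (hn : Computable n) : IsComputableRat fun a => (1 / 2 : ℚ) ^ n a :=
  of_eq_div (c := fun _ => 1) (d := fun _ => 0) (e := fun a => 2 ^ n a - 1)
    (by fun_prop) (by fun_prop) (by fun_prop) fun a => by
      simp [Nat.cast_pred (Nat.two_pow_pos (n a))]

theorem add (hf : IsComputableRat f) (hg : IsComputableRat g) :
    IsComputableRat fun a => f a + g a := by
  obtain ⟨c, hc, hcf⟩ := hf
  obtain ⟨d, hd, hdg⟩ := hg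
  refine of_eq_div
    (c := fun a => (c a).unpair.1.unpair.1 * ((d a).unpair.2 + 1) +
      (d a).unpair.1.unpair.1 * ((c a).unpair.2 + 1))
    (d := fun a => (c a).unpair.1.unpair.2 * ((d a).unpair.2 + 1) +
      (d a).unpair.1.unpair.2 * ((c a).unpair.2 + 1))
    (e := fun a => (c a).unpair.2 * (d a).unpair.2 + (c a).unpair.2 + (d a).unpair.2)
    (by fun_prop) (by fun_prop) (by fun_prop) fun a => ?_
  rw [← hcf, ← hdg, ratNum, ratNum, div_add_div _ _ (by positivity) (by positivity)]
  push_cast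
  congr 1 <;> ring

theorem neg (hf : IsComputableRat f) : IsComputableRat fun a => -f a := by
  obtain ⟨c, hc, hcf⟩ := hf
  refine of_eq_div (c := fun a => (c a).unpair.1.unpair.2) (d := fun a => (c a).unpair.1.unpair.1)
    (e := fun a => (c a).unpair.2) (by fun_prop) (by fun_prop) (by fun_prop) fun a => ?_
  rw [← hcf, ratNum, ← neg_div, neg_sub]

theorem sub (hf : IsComputableRat f) (hg : IsComputableRat g) :
    IsComputableRat fun a => f a - g a := by
  simpa only [sub_eq_add_neg] using hf.add hg.neg

theorem mul (hf : IsComputableRat f) (hg : IsComputableRat g) :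
    IsComputableRat fun a => f a * g a := by
  obtain ⟨c, hc, hcf⟩ := hf
  obtain ⟨d, hd, hdg⟩ := hg
  refine of_eq_div
    (c := fun a => (c a).unpair.1.unpair.1 * (d a).unpair.1.unpair.1 +
      (c a).unpair.1.unpair.2 * (d a).unpair.1.unpair.2)
    (d := fun a => (c a).unpair.1.unpair.1 * (d a).unpair.1.unpair.2 +
      (c a).unpair.1.unpair.2 * (d a).unpair.1.unpair.1)
    (e := fun a => (c a).unpair.2 * (d a).unpair.2 + (c a).unpair.2 + (d a).unpair.2)
    (by fun_prop) (by fun_prop) (by fun_prop) fun a => ?_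
  rw [← hcf, ← hdg, ratNum, ratNum, div_mul_div_comm]
  push_cast
  congr 1 <;> ring

theorem sum_range {f : α × ℕ → ℚ} (hf : IsComputableRat f) (hn : Computable n) :
    IsComputableRat fun a => ∑ i ∈ Finset.range (n a), f (a, i) := by
  obtain ⟨c, hc, hcf⟩ := hf
  obtain ⟨s, hs, hsum⟩ : IsComputableRat fun x : α × ℕ × ℕ =>
      ratNum x.2.2 + ratNum (c (x.1, x.2.1)) :=
    (of_ratNum (by fun_prop)).add (of_ratNum (by fun_prop))
  refine ⟨_, Computable.nat_rec (g := fun _ => 0) (h := fun a z => s (a, z)) hn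
    (Computable.const 0) hs, fun a => ?_⟩
  beta_reduce
  induction n a with
  | zero => simp [ratNum]
  | succ m ih => rw [Finset.sum_range_succ, ← ih, ← hcf]; exact hsum (a, m, _)

theorem sum_getD {l : α → List ℕ} (hl : Computable l) :
    IsComputableRat fun a => ∑ i ∈ Finset.range (l a).length, ratNum ((l a).getD i 0) :=
  sum_range (f := fun x : α × ℕ => ratNum ((l x.1).getD x.2 0)) (.of_ratNum (by fun_prop))
    (by fun_prop)

theorem decide_lt (hf : IsComputableRat f) (hg : IsComputableRat g) :
    Computable fun a => decide (f a < g a) := by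
  obtain ⟨c, hc, hcf⟩ := hf
  obtain ⟨d, hd, hdg⟩ := hg
  have hcross : Computable fun a => decide ((c a).unpair.1.unpair.1 * ((d a).unpair.2 + 1) +
      (d a).unpair.1.unpair.2 * ((c a).unpair.2 + 1) <
      (d a).unpair.1.unpair.1 * ((c a).unpair.2 + 1) +
        (c a).unpair.1.unpair.2 * ((d a).unpair.2 + 1)) :=
    computable_decide_lt (by fun_prop) (by fun_prop)
  exact hcross.of_eq fun a => by rw [decide_eq_decide, ← hcf, ← hdg, ratNum_lt_ratNum_iff]

theorem decide_eq (hf : IsComputableRat f) (hg : IsComputableRat g) :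
    Computable fun a => decide (f a = g a) := by
  refine (computable_and (computable_not (hf.decide_lt hg))
    (computable_not (hg.decide_lt hf))).of_eq fun a => ?_
  rw [← decide_not, ← decide_not, ← Bool.decide_and, decide_eq_decide, not_lt, not_lt, and_comm,
    le_antisymm_iff]

end IsComputableRat

theorem IsComputableMetricSpace.isSemidecidable_dist_lt {X : Type*} [MetricSpace X] {ν : ℕ → X}
    (hν : IsComputableMetricSpace ν) {c d : α → ℕ} {r : α → ℚ} (hc : Computable c)
    (hd : Computable d) (hr : IsComputableRat r) :
    IsSemidecidable fun a _ => dist (ν (c a)) (ν (d a)) < (r a : ℝ) := by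
  obtain ⟨g, hg, hdist⟩ := hν.computable_dist
  obtain ⟨e, he, her⟩ := hr
  have hcert : ∀ a, dist (ν (c a)) (ν (d a)) < (r a : ℝ) ↔
      ∃ m, ratNum (g (c a, d a, m)) + (1 / 2) ^ m < ratNum (e a) := fun a => by
    rw [her]
    simp only [← Rat.cast_lt (K := ℝ)]
    push_cast
    refine ⟨fun h => ?_, fun ⟨m, hm⟩ => ?_⟩
    · obtain ⟨m, hm⟩ := exists_pow_lt_of_lt_one (half_pos (sub_pos.2 h))
        (show (1 / 2 : ℝ) < 1 by norm_num)
      exact ⟨m, by linarith [(abs_le.1 (hdist (c a) (d a) m)).1]⟩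
    · linarith [(abs_le.1 (hdist (c a) (d a) m)).2]
  simp only [hcert]
  exact .exists_right (.of_computable (((IsComputableRat.of_ratNum (by fun_prop)).add
    (.half_pow (by fun_prop))).decide_lt (.of_ratNum (by fun_prop))))

end

/-! ### Ultrametric means -/

theorem exists_ne_zero_of_finsum_eq_one {ι R : Type*} [NonAssocSemiring R] [Nontrivial R]
    {w : ι → R} (hsum : ∑ᶠ i, w i = 1) : ∃ i, w i ≠ 0 := by
  by_contra! hw
  simp [hw] at hsum

section

variable {ι R : Type*} [NormedRing R] [IsUltrametricDist R]

theorem norm_mul_sub_mul_le {a b u v : R} {ε : ℝ} (hu : ‖u‖ ≤ 1) (hv : ‖b - v‖ ≤ ε)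
    (ha : ‖b‖ * ‖a - u‖ ≤ ε) : ‖b * a - v * u‖ ≤ ε :=
  calc ‖b * a - v * u‖ = ‖b * (a - u) + (b - v) * u‖ := by congr 1; noncomm_ring
    _ ≤ max ‖b * (a - u)‖ ‖(b - v) * u‖ := IsUltrametricDist.norm_add_le_max _ _
    _ ≤ ε := max_le ((norm_mul_le _ _).trans ha) <|
      (norm_mul_le _ _).trans <| (mul_le_of_le_one_right (norm_nonneg _) hu).trans hv

variable [Nontrivial R] {a w : ι → R}

theorem norm_finsum_mul_sub_le {d : R} {ρ : ℝ} (hw : ∀ i, ‖w i‖ ≤ 1) (hsum : ∑ᶠ i, w i = 1)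
    (ha : ∀ i, w i ≠ 0 → ‖a i - d‖ ≤ ρ) : ‖∑ᶠ i, a i * w i - d‖ ≤ ρ := by
  have hfin : w.support.Finite := hasFiniteSupport_of_finsum_eq_one hsum
  obtain ⟨i₀, hi₀⟩ := exists_ne_zero_of_finsum_eq_one hsum
  have hone : ∑ i ∈ hfin.toFinset, w i = 1 := by rw [← hsum, finsum_eq_sum w hfin]
  have hcentre : ∑ᶠ i, a i * w i - d = ∑ i ∈ hfin.toFinset, (a i - d) * w i := by
    rw [finsum_eq_sum_of_support_subset (s := hfin.toFinset) _ fun i hi => by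
      simpa using right_ne_zero_of_mul hi]
    simp only [sub_mul, Finset.sum_sub_distrib, ← Finset.mul_sum, hone, mul_one]
  rw [hcentre]
  refine IsUltrametricDist.norm_sum_le_of_forall_le_of_nonneg
    ((norm_nonneg _).trans (ha i₀ hi₀)) fun i hi => ?_
  calc ‖(a i - d) * w i‖ ≤ ‖a i - d‖ * ‖w i‖ := norm_mul_le _ _
    _ ≤ ‖a i - d‖ := mul_le_of_le_one_right (norm_nonneg _) (hw i)
    _ ≤ ρ := ha i (hfin.mem_toFinset.1 hi)

theorem UltrametricallyConvex.finsum_mul_mem {C : Set R} (hC : UltrametricallyConvex C)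
    (ha : ∀ i, w i ≠ 0 → a i ∈ C) (hw : ∀ i, ‖w i‖ ≤ 1) (hsum : ∑ᶠ i, w i = 1) :
    ∑ᶠ i, a i * w i ∈ C := by
  have hfin : w.support.Finite := hasFiniteSupport_of_finsum_eq_one hsum
  obtain ⟨i, hi⟩ := exists_ne_zero_of_finsum_eq_one hsum
  obtain ⟨j, hj, hmax⟩ := exists_max_image _ (fun k => dist (a i) (a k)) hfin ⟨i, hi⟩
  refine hC (a i) (ha i hi) (a j) (ha j hj) ?_
  rw [Metric.mem_closedBall, dist_eq_norm]
  refine norm_finsum_mul_sub_le hw hsum fun k hk => ?_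
  rw [← dist_eq_norm, dist_comm]
  exact hmax k hk

end

/-! ### The retraction -/

theorem isOpen_idealBall' {X : Type*} [MetricSpace X] (ν : ℕ → X) (a : ℕ) :
    IsOpen (idealBall' ν a) := by
  cases a with
  | zero => exact isOpen_empty
  | succ a => exact Metric.isOpen_ball

theorem retract_of_mem {X : Type*} [Nonempty X] {p : ℕ} [Fact p.Prime] {A : Set X} {y : ℕ → X}
    {f : ℕ → X →. ℚ_[p]} {h : X →. ℚ_[p]} {x : X} (hx : x ∈ A) : retract A y f h x = x :=
  if_pos hx

namespace ThetaDom

variable {X : Type*} [MetricSpace X] {ν : ℕ → X} {p : ℕ} [Fact p.Prime] {A : Set X}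
  {V : ℕ → Set X} {y : ℕ → X} {f : ℕ → X →. ℚ_[p]} {h : X →. ℚ_[p]} {x : X}

theorem isDugundjiSystem (H : ThetaDom ν A V y f h) : IsDugundjiSystem ν 1 A V y := by
  simpa only [DugundjiSystems, mem_ofPred_eq, H.compl_eq] using H.mem_systems

theorem mem_iUnion_iff (H : ThetaDom ν A V y f h) : x ∈ ⋃ i, V i ↔ x ∉ A := by
  rw [H.isDugundjiSystem.iUnion_eq, mem_compl_iff]

theorem val_mem_of_mem (H : ThetaDom ν A V y f h) (hx : x ∈ A) : h.val x ∈ h x :=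
  val_mem_of_mem_dom (by rwa [H.homeo.dom_eq])

theorem val_partition_mem (H : ThetaDom ν A V y f h) (hx : x ∉ A) (i : ℕ) :
    (f i).val x ∈ f i x :=
  val_mem_of_mem_dom (by rwa [H.partition.dom_eq, H.mem_iUnion_iff])

theorem norm_val_partition_le (H : ThetaDom ν A V y f h) (hx : x ∉ A) (i : ℕ) :
    ‖(f i).val x‖ ≤ 1 :=
  H.partition.norm_le_one i x (H.mem_iUnion_iff.2 hx)

theorem finsum_val_partition (H : ThetaDom ν A V y f h) (hx : x ∉ A) :
    ∑ᶠ i, (f i).val x = 1 :=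
  H.partition.sum_eq_one x (H.mem_iUnion_iff.2 hx)

theorem mem_of_val_ne_zero (H : ThetaDom ν A V y f h) (hx : x ∉ A) {i : ℕ}
    (hi : (f i).val x ≠ 0) : x ∈ V i :=
  H.partition.subordinate i x (H.mem_iUnion_iff.2 hx) hi

theorem support_mul_finite (H : ThetaDom ν A V y f h) (hx : x ∉ A) :
    (Function.support fun i => h.val (y i) * (f i).val x).Finite :=
  (hasFiniteSupport_of_finsum_eq_one (H.finsum_val_partition hx)).subset
    (Function.support_mul_subset_right _ _)

theorem finsum_mem (H : ThetaDom ν A V y f h) (hx : x ∉ A) :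
    ∑ᶠ i, h.val (y i) * (f i).val x ∈ h.val '' A :=
  H.homeo.convex.finsum_mul_mem (fun i _ => mem_image_of_mem _ (H.isDugundjiSystem.mem i))
    (H.norm_val_partition_le hx) (H.finsum_val_partition hx)

variable [Nonempty X]

theorem val_retract_of_notMem (H : ThetaDom ν A V y f h) (hx : x ∉ A) :
    h.val (retract A y f h x) = ∑ᶠ i, h.val (y i) * (f i).val x := by
  rw [retract, if_neg hx]
  exact Function.invFunOn_eq (H.finsum_mem hx)

theorem val_retract_eq_sum (H : ThetaDom ν A V y f h) (hx : x ∉ A) {s : Finset ℕ}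
    (hs : ∀ i, x ∈ V i → i ∈ s) :
    h.val (retract A y f h x) = ∑ i ∈ s, h.val (y i) * (f i).val x := by
  rw [H.val_retract_of_notMem hx]
  exact finsum_eq_sum_of_support_subset _ fun i hi =>
    hs i (H.mem_of_val_ne_zero hx (right_ne_zero_of_mul hi))

theorem retract_mem (H : ThetaDom ν A V y f h) (x : X) : retract A y f h x ∈ A := by
  by_cases hx : x ∈ A
  · rwa [retract_of_mem hx]
  · rw [retract, if_neg hx]
    exact Function.invFunOn_mem (H.finsum_mem hx)

theorem norm_val_retract_sub_le (H : ThetaDom ν A V y f h) {d : ℚ_[p]} {ρ : ℝ}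
    (hd : ∀ a ∈ A, dist x a ≤ 2 * Metric.infDist x A → ‖h.val a - d‖ ≤ ρ) :
    ‖h.val (retract A y f h x) - d‖ ≤ ρ := by
  by_cases hx : x ∈ A
  · rw [retract_of_mem hx]
    exact hd x hx (by simp [Metric.infDist_nonneg])
  · rw [H.val_retract_of_notMem hx]
    refine norm_finsum_mul_sub_le (H.norm_val_partition_le hx) (H.finsum_val_partition hx)
      fun i hi => hd _ (H.isDugundjiSystem.mem i) ?_
    linarith [H.isDugundjiSystem.dist_le i x (H.mem_of_val_ne_zero hx hi)]

theorem continuousAt_val_retract_of_mem (H : ThetaDom ν A V y f h) (hx : x ∈ A) :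
    ContinuousAt (fun x => h.val (retract A y f h x)) x := by
  have hcont : ContinuousOn h.val A :=
    continuousOn_iff_continuous_domRestrict.2 H.homeo.isEmbedding.continuous
  refine Metric.continuousAt_iff.2 fun ε hε => ?_
  obtain ⟨δ, hδ, hδε⟩ := Metric.continuousOn_iff.1 hcont x hx (ε / 2) (half_pos hε)
  refine ⟨δ / 3, by positivity, fun {x'} hx' => ?_⟩
  rw [dist_eq_norm, retract_of_mem hx]
  refine (H.norm_val_retract_sub_le fun a ha hxa => ?_).trans_lt (half_lt_self hε)
  rw [← dist_eq_norm]
  have hinf : Metric.infDist x' A ≤ dist x' x := Metric.infDist_le_dist_of_mem hx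
  exact (hδε a ha (by linarith [dist_triangle_left a x x'])).le

theorem continuousAt_val_retract_of_notMem (hν : DenseRange ν) (H : ThetaDom ν A V y f h)
    (hx : x ∉ A) : ContinuousAt (fun x => h.val (retract A y f h x)) x := by
  have hA : Aᶜ ∈ 𝓝 x := H.isDugundjiSystem.isClosed.isOpen_compl.mem_nhds hx
  obtain ⟨i, hi⟩ := mem_iUnion.1 (H.mem_iUnion_iff.2 hx)
  obtain ⟨b, hxb, hfin⟩ := H.isDugundjiSystem.locallyFinite.2 i x hi
  have hsum : ContinuousAt (fun x' => ∑ j ∈ hfin.toFinset, h.val (y j) * (f j).val x') x := by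
    refine tendsto_finsetSum _ fun j _ => tendsto_const_nhds.mul ?_
    refine ((H.partition.continuous j).continuousOn_val hν).continuousAt ?_
    rwa [H.partition.dom_eq, H.isDugundjiSystem.iUnion_eq]
  refine hsum.congr ?_
  filter_upwards [hA, (isOpen_idealBall' ν b).mem_nhds hxb] with x' hx' hx'b
  exact (H.val_retract_eq_sum hx' fun j hj => hfin.mem_toFinset.2 ⟨x', hj, hx'b⟩).symm

theorem continuous_val_retract (hν : DenseRange ν) (H : ThetaDom ν A V y f h) :
    Continuous fun x => h.val (retract A y f h x) :=
  continuous_iff_continuousAt.2 fun x => by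
    by_cases hx : x ∈ A
    · exact H.continuousAt_val_retract_of_mem hx
    · exact H.continuousAt_val_retract_of_notMem hν hx

theorem continuous_retract (hν : DenseRange ν) (H : ThetaDom ν A V y f h) :
    Continuous (retract A y f h) :=
  continuous_subtype_val.comp <| H.homeo.isEmbedding.continuous_iff
    (f := fun x => (⟨retract A y f h x, H.retract_mem x⟩ : A)).2 (H.continuous_val_retract hν)

end ThetaDom

/-! ### The denominator of a rational bounds its `p`-adic norm -/

section

variable {p : ℕ} [Fact p.Prime]

theorem inv_natCast_le_padicNorm {n : ℕ} (hn : n ≠ 0) : (n : ℝ)⁻¹ ≤ ‖(n : ℚ_[p])‖ := by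
  have hp : 0 < (p : ℝ) := by exact_mod_cast (Fact.out : p.Prime).pos
  rw [Padic.norm_eq_zpow_neg_valuation (Nat.cast_ne_zero.2 hn), Padic.valuation_natCast, zpow_neg,
    zpow_natCast]
  refine inv_anti₀ (by positivity) ?_
  exact_mod_cast Nat.le_of_dvd (Nat.pos_of_ne_zero hn) pow_padicValNat_dvd

theorem norm_ratNum_le (b : ℕ) : ‖(ratNum b : ℚ_[p])‖ ≤ b.unpair.2 + 1 := by
  have hnum := Padic.norm_int_le_one (p := p) (b.unpair.1.unpair.1 - b.unpair.1.unpair.2 : ℤ)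
  have hden := inv_natCast_le_padicNorm (p := p) b.unpair.2.succ_ne_zero
  push_cast at hnum hden
  calc ‖(ratNum b : ℚ_[p])‖
      = ‖(b.unpair.1.unpair.1 - b.unpair.1.unpair.2 : ℚ_[p])‖ / ‖(b.unpair.2 + 1 : ℚ_[p])‖ := by
        rw [← norm_div, ratNum]; push_cast; rfl
    _ ≤ 1 / ((b.unpair.2 : ℝ) + 1)⁻¹ := by gcongr
    _ = b.unpair.2 + 1 := by rw [one_div, inv_inv]

end

/-! ### Approximations of `h ∘ r` -/

/-- `t` names a tuple `(A; (V, y); f; h)` in the domain of `θ` together with a point `x`. -/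
structure ThetaInput {X : Type*} [MetricSpace X] (ν : ℕ → X) {p : ℕ} [Fact p.Prime] (t : Baire)
    (A : Set X) (V : ℕ → Set X) (y : ℕ → X) (f : ℕ → X →. ℚ_[p]) (h : X →. ℚ_[p]) (x : X) :
    Prop where
  dom : ThetaDom ν A V y f h
  naming : prodNaming (thetaInputNaming p ν) (cauchyNaming ν) t ((A, (V, y), f, h), x)

namespace ThetaInput

/-- The name of `x` contained in `t`. -/
def argument (t : Baire) : Baire := snd t

/-- The name, shifted by one, of the `i`-th point of a dense sequence in `A`. -/
def densePoint (t : Baire) (i : ℕ) : Baire := comp (fst (fst (fst t))) i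

/-- The codes, shifted by one, of ideal balls exhausting the complement of `A`. -/
def ballCode (t : Baire) : Baire := fst (snd (fst (fst (snd (fst t)))))

/-- The binary codes of finite sets containing the indices `j` for which `V j` meets the balls
given by `ballCode`. -/
def indexCode (t : Baire) : Baire := snd (snd (fst (fst (snd (fst t)))))

/-- The name of the point `y j`. -/
def point (t : Baire) (j : ℕ) : Baire := comp (snd (fst (snd (fst t)))) j

/-- The table of a realizer of `f j`. -/
def partitionTable (t : Baire) (j : ℕ) : Baire := fst (comp (fst (snd (snd (fst t)))) j)

/-- The table of a realizer of `h`. -/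
def homeoTable (t : Baire) : Baire := fst (snd (snd (snd (fst t))))

/-- `e` codes the product of an approximation of `h (y j)` and one of `f j x`. The precision
demanded of the latter makes up for the size of the former: the `p`-adic norm of `ratNum b` is at
most `b.unpair.2 + 1`, hence at most `2 ^ b.unpair.2`. -/
def ApproxTerm (t : Baire) (j n e : ℕ) : Prop :=
  ∃ k b k' a, Decides (homeoTable t) (point t j) n k b ∧
    Decides (partitionTable t j) (argument t) (n + b.unpair.2) k' a ∧
    ratNum e = ratNum b * ratNum a

/-- `d` approximates `h (r x)` for a reason that shows `x ∉ A`: some ball in the complement of `A`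
contains `x`, and `d` is the sum of approximations of all terms that do not vanish on this ball. -/
def FarApprox {X : Type*} [MetricSpace X] (ν : ℕ → X) (t : Baire) (n d : ℕ) : Prop :=
  ∃ i a m c, ∃ l : List ℕ, ballCode t i = a + 1 ∧ argument t m = c ∧
    dist (ν c) (ν a.unpair.1) < ((posRatNum a.unpair.2 - (1 / 2) ^ m : ℚ) : ℝ) ∧
    indexCode t i = l.length ∧ (∀ j < l.length, ApproxTerm t j n (l.getD j 0)) ∧
    ratNum d = ∑ j ∈ Finset.range l.length, ratNum (l.getD j 0)

/-- `d` approximates `h (r x)` because `x` is close to `A`: the realizer of `h` produces `d` from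
the first `k` entries of a name of `x`, and some point of `A` is so close to `x` that these entries
also begin names of all points of `A` that are almost closest to `x`. -/
def NearApprox {X : Type*} [MetricSpace X] (ν : ℕ → X) (t : Baire) (n d : ℕ) : Prop :=
  ∃ k i a b, Decides (homeoTable t) (fun m => argument t (m + 1)) n k d ∧
    argument t (k + 4) = a ∧ densePoint t i (k + 4) = b + 1 ∧
    dist (ν a) (ν b) < (((1 / 2) ^ (k + 2) : ℚ) : ℝ)

section

variable {α : Type*} [Primcodable α] {j n d : α → ℕ}

theorem isReindexing_argument : IsReindexing fun (_ : α) => argument :=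
  IsReindexing.id.snd

theorem isReindexing_ballCode : IsReindexing fun (_ : α) => ballCode :=
  IsReindexing.id.fst.snd.fst.fst.snd.fst

theorem isReindexing_indexCode : IsReindexing fun (_ : α) => indexCode :=
  IsReindexing.id.fst.snd.fst.fst.snd.snd

theorem isReindexing_homeoTable : IsReindexing fun (_ : α) => homeoTable :=
  IsReindexing.id.fst.snd.snd.snd.fst

theorem isReindexing_densePoint (hj : Computable j) :
    IsReindexing fun a t => densePoint t (j a) :=
  IsReindexing.id.fst.fst.fst.comp hj

theorem isReindexing_point (hj : Computable j) : IsReindexing fun a t => point t (j a) :=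
  (IsReindexing.id.fst.snd.fst.snd).comp hj

theorem isReindexing_partitionTable (hj : Computable j) :
    IsReindexing fun a t => partitionTable t (j a) :=
  (IsReindexing.id.fst.snd.snd.fst.comp hj).fst

theorem isSemidecidable_approxTerm (hj : Computable j) (hn : Computable n) (hd : Computable d) :
    IsSemidecidable fun a t => ApproxTerm t (j a) (n a) (d a) := by
  refine .exists_right <| .exists_right <| .exists_right <| .exists_right <| .and ?_ <| .and ?_ ?_
  · exact .decides isReindexing_homeoTable (isReindexing_point (by fun_prop)) (by fun_prop)
      (by fun_prop) (by fun_prop)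
  · exact .decides (isReindexing_partitionTable (by fun_prop)) isReindexing_argument (by fun_prop)
      (by fun_prop) (by fun_prop)
  · exact .of_computable <| IsComputableRat.decide_eq (.of_ratNum (by fun_prop)) <|
      .mul (.of_ratNum (by fun_prop)) (.of_ratNum (by fun_prop))

variable {X : Type*} [MetricSpace X] {ν : ℕ → X}

theorem isSemidecidable_farApprox (hν : IsComputableMetricSpace ν) (hn : Computable n)
    (hd : Computable d) : IsSemidecidable fun a t => FarApprox ν t (n a) (d a) := by
  refine .exists_right <| .exists_right <| .exists_right <| .exists_right <| .exists_right <|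
    .and ?_ <| .and ?_ <| .and ?_ <| .and ?_ <| .and ?_ ?_
  · exact .oracle_eq isReindexing_ballCode (by fun_prop) (by fun_prop)
  · exact .oracle_eq isReindexing_argument (by fun_prop) (by fun_prop)
  · exact hν.isSemidecidable_dist_lt (by fun_prop) (by fun_prop) <|
      .sub (.of_posRatNum (by fun_prop)) (.half_pow (by fun_prop))
  · exact .oracle_eq isReindexing_indexCode (by fun_prop) (by fun_prop)
  · exact .forall_lt (isSemidecidable_approxTerm (by fun_prop) (by fun_prop) (by fun_prop))
      (by fun_prop)
  · exact .of_computable <| IsComputableRat.decide_eq (.of_ratNum (by fun_prop)) <|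
      .sum_getD (by fun_prop)

theorem isSemidecidable_nearApprox (hν : IsComputableMetricSpace ν) (hn : Computable n)
    (hd : Computable d) : IsSemidecidable fun a t => NearApprox ν t (n a) (d a) := by
  refine .exists_right <| .exists_right <| .exists_right <| .exists_right <|
    .and ?_ <| .and ?_ <| .and ?_ ?_
  · exact .decides isReindexing_homeoTable
      (isReindexing_argument.reindex (g := fun x => x.2 + 1) (by fun_prop)) (by fun_prop)
      (by fun_prop) (by fun_prop)
  · exact .oracle_eq isReindexing_argument (by fun_prop) (by fun_prop)
  · exact .oracle_eq (isReindexing_densePoint (by fun_prop)) (by fun_prop) (by fun_prop)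
  · exact hν.isSemidecidable_dist_lt (by fun_prop) (by fun_prop) (.half_pow (by fun_prop))

end
variable {X : Type*} [MetricSpace X] {ν : ℕ → X} {p : ℕ} [Fact p.Prime] {t : Baire} {A : Set X}
  {V : ℕ → Set X} {y : ℕ → X} {f : ℕ → X →. ℚ_[p]} {h : X →. ℚ_[p]} {x : X} {n d : ℕ}

theorem cauchyNaming_argument (T : ThetaInput ν t A V y f h x) :
    cauchyNaming ν (argument t) x :=
  T.naming.2

theorem homeoTable_realizes (T : ThetaInput ν t A V y f h x) :
    Realizes (cauchyNaming ν) (padicNaming p) (eta (homeoTable t)) h :=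
  T.naming.1.2.2.2.1

theorem partitionTable_realizes (T : ThetaInput ν t A V y f h x) (j : ℕ) :
    Realizes (cauchyNaming ν) (padicNaming p) (eta (partitionTable t j)) (f j) :=
  (T.naming.1.2.2.1 j).1

theorem cauchyNaming_point (T : ThetaInput ν t A V y f h x) (j : ℕ) :
    cauchyNaming ν (point t j) (y j) :=
  T.naming.1.2.1.2.2 j

theorem mem_iUnion_ballCode_iff (T : ThetaInput ν t A V y f h x) :
    x ∈ ⋃ i, idealBall' ν (ballCode t i) ↔ x ∉ A := by
  have hV : (⋃ j, V j) = ⋃ i, idealBall' ν (ballCode t i) := T.naming.1.2.1.2.1.2.2.1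
  rw [← hV, T.dom.mem_iUnion_iff]

theorem lt_indexCode (T : ThetaInput ν t A V y f h x) {i j : ℕ} (hj : x ∈ V j)
    (hi : x ∈ idealBall' ν (ballCode t i)) : j < indexCode t i :=
  Nat.lt_two_pow_self.trans_le <|
    Nat.ge_two_pow_of_testBit (T.naming.1.2.1.2.1.2.2.2 i j ⟨x, hj, hi⟩)

theorem exists_dense (T : ThetaInput ν t A V y f h x) :
    ∃ z : ℕ → X, (∀ i, (∀ k, 1 ≤ densePoint t i k) ∧
      cauchyNaming ν (fun k => densePoint t i k - 1) (z i) ∧ z i ∈ A) ∧ A ⊆ closure (range z) :=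
  T.naming.1.1.1.2.elim (fun hA => absurd hA.1 T.dom.nonempty.ne_empty) fun hA => hA.2

theorem exists_approxTerm (T : ThetaInput ν t A V y f h x) (hx : x ∉ A) (j n : ℕ) :
    ∃ e, ApproxTerm t j n e := by
  obtain ⟨k, b, hb⟩ := T.homeoTable_realizes.exists_decides (T.cauchyNaming_point j)
    (T.dom.val_mem_of_mem (T.dom.isDugundjiSystem.mem j)) n
  obtain ⟨k', a, ha⟩ := (T.partitionTable_realizes j).exists_decides T.cauchyNaming_argument
    (T.dom.val_partition_mem hx j) (n + b.unpair.2)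
  obtain ⟨e, he⟩ := ratNum_surjective (ratNum b * ratNum a)
  exact ⟨e, k, b, k', a, hb, ha, he⟩

theorem norm_sub_le_of_approxTerm (T : ThetaInput ν t A V y f h x) (hx : x ∉ A) {j e : ℕ}
    (he : ApproxTerm t j n e) :
    ‖(ratNum e : ℚ_[p]) - h.val (y j) * (f j).val x‖ ≤ (1 / 2) ^ n := by
  obtain ⟨k, b, k', a, hb, ha, he⟩ := he
  have hbv := T.homeoTable_realizes.dist_le_of_decides (T.cauchyNaming_point j)
    (T.dom.val_mem_of_mem (T.dom.isDugundjiSystem.mem j)) hb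
  have hau := (T.partitionTable_realizes j).dist_le_of_decides T.cauchyNaming_argument
    (T.dom.val_partition_mem hx j) ha
  rw [dist_eq_norm] at hbv hau
  have hb₂ : (b.unpair.2 : ℝ) + 1 ≤ 2 ^ b.unpair.2 := by exact_mod_cast Nat.lt_two_pow_self
  rw [he, Rat.cast_mul]
  refine norm_mul_sub_mul_le (T.dom.norm_val_partition_le hx j) hbv ?_
  calc ‖(ratNum b : ℚ_[p])‖ * ‖(ratNum a : ℚ_[p]) - (f j).val x‖
      ≤ 2 ^ b.unpair.2 * (1 / 2) ^ (n + b.unpair.2) := by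
        gcongr
        exact (norm_ratNum_le b).trans hb₂
    _ = (1 / 2) ^ n := by
        rw [pow_add, mul_left_comm, ← mul_pow]
        norm_num

theorem exists_farApprox (T : ThetaInput ν t A V y f h x) (hx : x ∉ A) (n : ℕ) :
    ∃ d, FarApprox ν t n d := by
  obtain ⟨i, hi⟩ := mem_iUnion.1 (T.mem_iUnion_ballCode_iff.2 hx)
  obtain ⟨a, ha⟩ : ∃ a, ballCode t i = a + 1 :=
    Nat.exists_eq_succ_of_ne_zero fun h0 => by simp [h0, idealBall'] at hi
  have hxa : dist x (ν a.unpair.1) < posRatNum a.unpair.2 := by rwa [ha] at hi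
  obtain ⟨m, hm⟩ := exists_pow_lt_of_lt_one (half_pos (sub_pos.2 hxa))
    (show (1 / 2 : ℝ) < 1 by norm_num)
  choose e he using fun j => T.exists_approxTerm hx j n
  let l := (List.range (indexCode t i)).map e
  obtain ⟨d, hd⟩ := ratNum_surjective (∑ j ∈ Finset.range l.length, ratNum (l.getD j 0))
  refine ⟨d, i, a, m, argument t m, l, ha, rfl, ?_, by simp [l], fun j hj => ?_, hd⟩
  · push_cast
    linarith [T.cauchyNaming_argument.dist_le m,
      dist_triangle (ν (argument t m)) x (ν a.unpair.1)]
  · rw [List.getD_eq_getElem _ _ hj]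
    simpa [l] using he j

theorem exists_nearApprox (T : ThetaInput ν t A V y f h x) (hx : x ∈ A) (n : ℕ) :
    ∃ d, NearApprox ν t n d := by
  obtain ⟨k, d, hd⟩ := T.homeoTable_realizes.exists_decides T.cauchyNaming_argument.shift
    (T.dom.val_mem_of_mem hx) n
  obtain ⟨z, hz, hdense⟩ := T.exists_dense
  obtain ⟨_, ⟨i, rfl⟩, hi⟩ := Metric.mem_closure_iff.1 (hdense hx) ((1 / 2) ^ (k + 4))
    (by positivity)
  let b := densePoint t i (k + 4) - 1
  refine ⟨d, k, i, argument t (k + 4), b, hd, rfl, (Nat.sub_add_cancel ((hz i).1 _)).symm, ?_⟩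
  have hb : dist (z i) (ν b) ≤ (1 / 2) ^ (k + 4) := by
    rw [dist_comm]
    exact (hz i).2.1.dist_le (k + 4)
  push_cast
  calc dist (ν (argument t (k + 4))) (ν b)
      ≤ dist (ν (argument t (k + 4))) x + dist x (z i) + dist (z i) (ν b) := dist_triangle4 _ _ _ _
    _ < (1 / 2) ^ (k + 4) + (1 / 2) ^ (k + 4) + (1 / 2) ^ (k + 4) + (1 / 2) ^ (k + 4) := by
      have := T.cauchyNaming_argument.dist_le (k + 4)
      have : (0 : ℝ) < (1 / 2) ^ (k + 4) := by positivity
      linarith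
    _ = (1 / 2) ^ (k + 2) := by ring

variable [Nonempty X]

theorem norm_sub_le_of_farApprox (T : ThetaInput ν t A V y f h x) (hd : FarApprox ν t n d) :
    ‖h.val (retract A y f h x) - (ratNum d : ℚ_[p])‖ ≤ (1 / 2) ^ n := by
  obtain ⟨i, a, m, c, l, ha, rfl, hc, hl, hterm, hd⟩ := hd
  push_cast at hc
  have hxi : x ∈ idealBall' ν (ballCode t i) := by
    rw [ha]
    refine Metric.mem_ball.2 ?_
    linarith [T.cauchyNaming_argument.dist_le m,
      dist_triangle_left x (ν a.unpair.1) (ν (argument t m))]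
  have hx : x ∉ A := T.mem_iUnion_ballCode_iff.1 (mem_iUnion_of_mem i hxi)
  rw [T.dom.val_retract_eq_sum hx (s := Finset.range l.length) fun j hj =>
      Finset.mem_range.2 (hl ▸ T.lt_indexCode hj hxi),
    hd, Rat.cast_sum, ← Finset.sum_sub_distrib]
  refine IsUltrametricDist.norm_sum_le_of_forall_le_of_nonneg (by positivity) fun j hj => ?_
  rw [norm_sub_rev]
  exact T.norm_sub_le_of_approxTerm hx (hterm j (Finset.mem_range.1 hj))

theorem norm_sub_le_of_nearApprox (hν : DenseRange ν) (T : ThetaInput ν t A V y f h x)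
    (hd : NearApprox ν t n d) :
    ‖h.val (retract A y f h x) - (ratNum d : ℚ_[p])‖ ≤ (1 / 2) ^ n := by
  obtain ⟨k, i, a, b, hd, rfl, hb, hab⟩ := hd
  push_cast at hab
  obtain ⟨z, hz, -⟩ := T.exists_dense
  have hbz : dist (ν b) (z i) ≤ (1 / 2) ^ (k + 4) := by
    simpa only [hb, Nat.add_sub_cancel] using (hz i).2.1.dist_le (k + 4)
  have hinf : Metric.infDist x A < (1 / 2) ^ (k + 2) + 2 * (1 / 2) ^ (k + 4) := by
    have hax := T.cauchyNaming_argument.dist_le (k + 4)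
    rw [dist_comm] at hax
    linarith [Metric.infDist_le_dist_of_mem (x := x) (hz i).2.2,
      dist_triangle4 x (ν (argument t (k + 4))) (ν b) (z i)]
  refine T.dom.norm_val_retract_sub_le fun c hc hxc => ?_
  rw [← dist_eq_norm, dist_comm]
  refine T.homeoTable_realizes.dist_le_of_decides_of_lt hν T.cauchyNaming_argument.shift hd
    (fun m hm => ?_) (T.dom.val_mem_of_mem hc)
  have hkm : (1 / 2 : ℝ) ^ k ≤ (1 / 2) ^ (m + 1) := half_pow_le_half_pow hm
  calc dist (ν (argument t (m + 1))) c ≤ dist (ν (argument t (m + 1))) x + dist x c :=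
        dist_triangle _ _ _
    _ < (1 / 2) ^ (m + 1) + 2 * ((1 / 2) ^ (k + 2) + 2 * (1 / 2) ^ (k + 4)) := by
        linarith [T.cauchyNaming_argument.dist_le (m + 1)]
    _ ≤ (1 / 2) ^ (m + 1) + (1 / 2) ^ (m + 1) := by
        have : (0 : ℝ) < (1 / 2) ^ k := by positivity
        gcongr
        rw [pow_add, pow_add]
        linarith
    _ = (1 / 2) ^ m := by ring

end ThetaInput

theorem isComputableMap_theta {X : Type*} [MetricSpace X] [Nonempty X] {ν : ℕ → X}
    (hν : IsComputableMetricSpace ν) (p : ℕ) [Fact p.Prime] :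
    IsComputableMap (thetaInputNaming p ν) (funNaming (cauchyNaming ν) (padicNaming p))
      (theta (p := p) ν) := by
  have hnear : IsSemidecidable fun (z : ℕ × ℕ) t => ThetaInput.NearApprox ν t z.1 z.2 :=
    ThetaInput.isSemidecidable_nearApprox hν (by fun_prop) (by fun_prop)
  have hfar : IsSemidecidable fun (z : ℕ × ℕ) t => ThetaInput.FarApprox ν t z.1 z.2 :=
    ThetaInput.isSemidecidable_farApprox hν (by fun_prop) (by fun_prop)
  refine .curry (isComputableMap_of_isSemidecidable (hnear.or hfar) ?_ ?_)
  · rintro t ⟨⟨A, ⟨V, y⟩, f, h⟩, x⟩ _ ht ⟨H, -⟩ n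
    have T : ThetaInput ν t A V y f h x := ⟨H, ht⟩
    by_cases hx : x ∈ A
    · exact (T.exists_nearApprox hx n).imp fun _ => .inl
    · exact (T.exists_farApprox hx n).imp fun _ => .inr
  · rintro t ⟨⟨A, ⟨V, y⟩, f, h⟩, x⟩ _ ht ⟨H, rfl⟩ n d hd
    have T : ThetaInput ν t A V y f h x := ⟨H, ht⟩
    rw [dist_comm, dist_eq_norm]
    exact hd.elim (T.norm_sub_le_of_nearApprox hν.dense) T.norm_sub_le_of_farApprox

theorem mainTheorem4_general {X : Type*} [MetricSpace X] [Nonempty X] (ν : ℕ → X)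
    (hν : IsComputableMetricSpace ν) (p : ℕ) [Fact p.Prime] :
    (∀ (A : Set X) (V : ℕ → Set X) (y : ℕ → X) (f : ℕ → X →. ℚ_[p]) (h : X →. ℚ_[p]),
      ThetaDom ν A V y f h →
        (∀ x ∉ A, (Function.support fun i => h.val (y i) * (f i).val x).Finite ∧
          ∑ᶠ i, h.val (y i) * (f i).val x ∈ h.val '' A) ∧
        Continuous (retract A y f h) ∧
        Continuous (fun x => h.val (retract A y f h x))) ∧
    IsComputableMap (thetaInputNaming p ν)
      (funNaming (cauchyNaming ν) (padicNaming p)) (theta (p := p) ν) :=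
  ⟨fun _ _ _ _ _ H => ⟨fun _ hx => ⟨H.support_mul_finite hx, H.finsum_mem hx⟩,
    H.continuous_retract hν.dense, H.continuous_val_retract hν.dense⟩, isComputableMap_theta hν p⟩

theorem mainTheorem4 {X : Type*} [MetricSpace X] [Nonempty X] (ν : ℕ → X)
    (hν : IsComputableMetricSpace ν) (hdim : IsZeroDimensional X)
    (p : ℕ) [Fact p.Prime]
    (hβ_compact : ∀ (x : X) (N : ℕ), IsCompact (Metric.closedBall x ((1 / 2 : ℝ) ^ N)))
    (hβ : IsComputableMap (prodNaming (cauchyNaming ν) natNaming) (compactNaming ν)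
      (PFun.lift fun z : X × ℕ => Metric.closedBall z.1 ((1 / 2 : ℝ) ^ z.2))) :
    -- the operator is well defined, with values in the continuous maps
    (∀ (A : Set X) (V : ℕ → Set X) (y : ℕ → X) (f : ℕ → X →. ℚ_[p]) (h : X →. ℚ_[p]),
      ThetaDom ν A V y f h →
        (∀ x ∉ A, (Function.support fun i => h.val (y i) * (f i).val x).Finite ∧
          ∑ᶠ i, h.val (y i) * (f i).val x ∈ h.val '' A) ∧
        Continuous (retract A y f h) ∧
        Continuous (fun x => h.val (retract A y f h x))) ∧
    -- and it is computable
    IsComputableMap (thetaInputNaming p ν)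
      (funNaming (cauchyNaming ν) (padicNaming p)) (theta (p := p) ν) := by
  exact mainTheorem4_general ν hν p
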